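/- Let $d\ge 0$ be an integer, $\lambda>0$, and let $f:[0,\infty)\to[0,\infty)$ be measurable with $f(0)=0$ and $0<\int_{\mathbb R^d}f(\|x\|)\,dx<\infty$. Let $\Psi$ be a Poisson point process on $\mathbb R^d\times(0,\infty)$ with intensity $\lambda$ times Lebesgue measure; a point $p=(x_p,b_p)\in\Psi$ is born at location $x_p$ at time $b_p$. Let $\mathcal Z_0$ (the augmentation) be a point process on $\mathbb R^d$, independent of $\Psi$, whose points are all born at time $0$. Given the points, attach to each unordered pair $\{p,q\}$ of distinct points of $\mathcal Z_0\cup\Psi$, independently over pairs, a connection time $T_{pq}=T_{qp}$ distributed as $\max(b_p,b_q)+\mathrm{Exp}\bigl(2f(\|x_p-x_q\|)\bigr)$ (equal to $\infty$ if the rate is $0$) and an independent fair coin $I_{pq}=1-I_{qp}\in\{0,1\}$; $I_{pq}=1$ means that at time $T_{pq}$ the point $q$ kills $p$ provided both are then alive. Assume that almost surely (1) for every $p\in\mathcal Z_0\cup\Psi$ and every $t<\infty$, only finitely many $w\in\mathcal Z_0$ satisfy $T_{pw}\le t$; (2) there is no infinite sequence $p_1,p_2,\dots$ in $\mathcal Z_0\cup\Psi$,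 with $p_n\in\mathcal Z_0$ for infinitely many $n$, along which $T_{p_1p_2}>T_{p_2p_3}>\cdots$. For a set $S$ of points, death times of the system $S$ are numbers $(e_p)_{p\in S}$ in $[0,\infty]$ with $$e_p=\inf\{T_{pq}:\ q\in S,\ e_q\ge T_{pq},\ I_{pq}=1\}\qquad(p\in S),\qquad \inf\emptyset=\infty .$$ Then, almost surely, the non-augmented system $S=\Psi$ and the augmented system $S=\mathcal Z_0\cup\Psi$ have unique death times, denoted $(d_p)$ and $(d'_p)$ respectively; put $d_z=0$ for $z\in\mathcal Z_0$. At time $t$, a point $p$ is called a zombie if $d_p\le t<d'_p$ and an antizombie if $d'_p\le t<d_p$. When a zombie kills, in the augmented system, a point $q$ that remains alive in the non-augmented system, $q$ becomes an antizombie; when an antizombie kills, in the non-augmented system, a point $q$ that remains alive in the augmented system, $q$ becomes a zombie; in both cases $q$ is called a child of its killer. For $z\in\mathcal Z_0$ let $A_t(z)$ (resp. $Z_t(z)$) be the set of antizombies (resp. zombies) at time $t$ that are $z$ itself or are obtained from $z$ by finitely many successive passages to a child, and for $t_1\in(0,\infty]$ let $$O_{t_1}(z)=\bigcup_{0\le t<t_1}\bigl(A_t(z)\cup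 Z_t(z)\bigr)$$ be the family of zombie and antizombie offspring of $z$ up to time $t_1$. Theorem. Almost surely, for every $z\in\mathcal Z_0$ and every $t_1\in(0,\infty]$, including $t_1=\infty$, the family $O_{t_1}(z)$ is finite. -/

import Mathlib

open MeasureTheory ProbabilityTheory Filter
open scoped ENNReal NNReal

/-- The number of points of the sequence `y` (counted with multiplicity) lying in `B`. -/
noncomputable def pointCount {Ω X : Type*} (y : ℕ → Ω → X) (B : Set X) (ω : Ω) : ℕ∞ :=
  {k | y k ω ∈ B}.encard

/-- The random points `y 0, y 1, …` form (an enumeration of) a Poisson point process with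
intensity measure `μ`: counts of sets of finite intensity are Poisson distributed, and counts of
pairwise disjoint sets are independent. -/
structure IsPoissonPointProcess {Ω X : Type*} [MeasurableSpace Ω] [MeasurableSpace X]
    (P : Measure Ω) (y : ℕ → Ω → X) (μ : Measure X) : Prop where
  measurable : ∀ k, Measurable (y k)
  hasLaw_count : ∀ B : Set X, MeasurableSet B → μ B < ∞ →
    HasLaw (pointCount y B)
      ((poissonMeasure (μ B).toNNReal).map (fun n : ℕ => (n : ℕ∞))) P
  iIndepFun_count : ∀ (n : ℕ) (B : Fin n → Set X), (∀ i, MeasurableSet (B i)) →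
    Pairwise (fun i j => Disjoint (B i) (B j)) → iIndepFun (fun i => pointCount y (B i)) P

/-- Labels of the points: `Sum.inl k` is the `k`-th point of the augmentation `Z₀` and
`Sum.inr k` is the `k`-th point of the birth process `Ψ`. -/
abbrev PtLabel : Type := ℕ ⊕ ℕ

/-- One realization of the system.
* `numZ`, `z`: the points of `Z₀` are `z k` for `k < numZ`, all born at time `0`;
* `y`: the points of `Ψ`, as pairs (location, birth time);
* `clock`, `coin`: the marks attached to the unordered pairs of points. -/
structure Realization (d : ℕ) where
  numZ : ℕ∞
  z : ℕ → EuclideanSpace ℝ (Fin d)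
  y : ℕ → EuclideanSpace ℝ (Fin d) × ℝ
  clock : Sym2 PtLabel → ℝ
  coin : Sym2 PtLabel → Bool

namespace Realization

variable {d : ℕ}

/-- (The labels of) the points of the augmentation. -/
def ptsZ (c : Realization d) : Set PtLabel := {p | ∃ k : ℕ, (k : ℕ∞) < c.numZ ∧ p = Sum.inl k}

/-- (The labels of) the points of the birth process `Ψ`. -/
def ptsPsi (_c : Realization d) : Set PtLabel := Set.range Sum.inr

/-- All points of the augmented system, `Z₀ ∪ Ψ`. -/
def pts (c : Realization d) : Set PtLabel := c.ptsZ ∪ c.ptsPsi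

/-- Location `x_p`. -/
def loc (c : Realization d) : PtLabel → EuclideanSpace ℝ (Fin d)
  | Sum.inl k => c.z k
  | Sum.inr k => (c.y k).1

/-- Birth time `b_p`. -/
def birth (c : Realization d) : PtLabel → ℝ
  | Sum.inl _ => 0
  | Sum.inr k => (c.y k).2

/-- The connection time `T_{pq} = T_{qp} = (b_p ∨ b_q) + E / (2 f(‖x_p - x_q‖))`, `E` the clock of
the pair; it is `∞` when the rate is `0`. With `E` of law `Exp(1)` this is `b_p ∨ b_q` plus an
exponential time of rate `2 f(‖x_p - x_q‖)`. -/
noncomputable def T (c : Realization d) (f : ℝ → ℝ) (p q : PtLabel) : ℝ≥0∞ :=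
  if f ‖c.loc p - c.loc q‖ = 0 then ∞
  else ENNReal.ofReal
    (max (c.birth p) (c.birth q) + c.clock s(p, q) / (2 * f ‖c.loc p - c.loc q‖))

/-- `I_{pq} = 1`: the connection of `p` and `q` is directed from `q` to `p`, i.e. `p` is the one
who dies if both are alive. For `p ≠ q` exactly one of `I p q`, `I q p` holds, and which one is
decided by the coin of the pair. -/
def I (c : Realization d) (p q : PtLabel) : Prop :=
  c.coin s(p, q) = decide (Encodable.encode p < Encodable.encode q)

/-- `e` is the family of death times of the system consisting of the points in `S`:
`e_p = inf {T_{pq} : q ∈ S, e_q ≥ T_{pq}, I_{pq} = 1}` for `p ∈ S` (`∞` if this set is empty).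
Points that are not in the system count as dead from time `0` on. -/
def IsDeathTimes (c : Realization d) (f : ℝ → ℝ) (S : Set PtLabel) (e : PtLabel → ℝ≥0∞) : Prop :=
  ∀ p, (p ∈ S → e p = sInf {t | ∃ q ∈ S, t = c.T f p q ∧ c.T f p q ≤ e q ∧ c.I p q}) ∧
    (p ∉ S → e p = 0)

/-- For death times `e` (non-augmented system) and `e'` (augmented system), `TurnsSpecial p q` says
that `q` is killed by the special point `p` while regular, and so becomes special itself:
* either `p` is a zombie (dead in the non-augmented and alive in the augmented system) just before
  `T_{pq}` and kills `q` at that time in the augmented system, where `q` is still alive in the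
  non-augmented one, so that `q` becomes an antizombie;
* or `p` is an antizombie and `q` becomes a zombie, with the two systems exchanged. -/
def TurnsSpecial (c : Realization d) (f : ℝ → ℝ) (e e' : PtLabel → ℝ≥0∞) (p q : PtLabel) : Prop :=
  c.I q p ∧
    ((e p < c.T f p q ∧ c.T f p q ≤ e' p ∧ e' q = c.T f p q ∧ c.T f p q < e q) ∨
     (e' p < c.T f p q ∧ c.T f p q ≤ e p ∧ e q = c.T f p q ∧ c.T f p q < e' q))

/-- `p` originates from `z`: it is `z`, or was turned special by `z`, or by a point turned special
by `z`, and so on. -/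
def Originates (c : Realization d) (f : ℝ → ℝ) (e e' : PtLabel → ℝ≥0∞) (z p : PtLabel) : Prop :=
  Relation.ReflTransGen (c.TurnsSpecial f e e') z p

/-- `A_t(z)`: the points originating from `z` that are antizombies at time `t`, i.e. dead in the
augmented and alive in the non-augmented system. -/
def antizombies (c : Realization d) (f : ℝ → ℝ) (e e' : PtLabel → ℝ≥0∞) (z : PtLabel) (t : ℝ≥0) :
    Set PtLabel :=
  {p | c.Originates f e e' z p ∧ e' p ≤ t ∧ t < e p}

/-- `Z_t(z)`: the points originating from `z` that are zombies at time `t`, i.e. dead in the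
non-augmented and alive in the augmented system. -/
def zombies (c : Realization d) (f : ℝ → ℝ) (e e' : PtLabel → ℝ≥0∞) (z : PtLabel) (t : ℝ≥0) :
    Set PtLabel :=
  {p | c.Originates f e e' z p ∧ e p ≤ t ∧ t < e' p}

/-- The family `O_{t₁}(z)`, the union of `A_t(z) ∪ Z_t(z)` over `t ∈ [0, t₁)`; `t₁ = ∞` is
allowed. -/
def family (c : Realization d) (f : ℝ → ℝ) (e e' : PtLabel → ℝ≥0∞) (t₁ : ℝ≥0∞) (z : PtLabel) :
    Set PtLabel :=
  ⋃ (t : ℝ≥0) (_ : (t : ℝ≥0∞) < t₁), c.antizombies f e e' z t ∪ c.zombies f e e' z t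

end Realization

/-- The probabilistic model in dimension `d` with birth intensity `lam`:
* `Ψ` is a Poisson point process on `ℝ^d × (0, ∞)` with intensity `lam` times Lebesgue measure;
* `Z₀` is a point process on `ℝ^d`, independent of `Ψ`;
* the marks of the pairs are independent of each other and of all points, each consisting of an
  `Exp(1)` clock and an independent fair coin. -/
structure IsRandomSystem {Ω : Type*} [MeasurableSpace Ω] (P : Measure Ω) {d : ℕ} (lam : ℝ)
    (R : Ω → Realization d) : Prop where
  poisson : IsPoissonPointProcess P (fun k ω => (R ω).y k)
    (ENNReal.ofReal lam •
      (volume : Measure (EuclideanSpace ℝ (Fin d))).prod (volume.restrict (Set.Ioi (0 : ℝ))))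
  measurable_numZ : Measurable (fun ω => (R ω).numZ)
  measurable_z : ∀ k, Measurable (fun ω => (R ω).z k)
  locallyFinite_Z : ∀ᵐ ω ∂P, ∀ r : ℝ, {p ∈ (R ω).ptsZ | ‖(R ω).loc p‖ ≤ r}.Finite
  indep_Z_Psi : IndepFun (fun ω => ((R ω).numZ, (R ω).z)) (fun ω => (R ω).y) P
  hasLaw_mark : ∀ s : Sym2 PtLabel, HasLaw (fun ω => ((R ω).clock s, (R ω).coin s))
    ((expMeasure 1).prod (PMF.uniformOfFintype Bool).toMeasure) P
  iIndepFun_mark : iIndepFun (fun (s : Sym2 PtLabel) ω => ((R ω).clock s, (R ω).coin s)) P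
  indep_points_marks : IndepFun (fun ω => (((R ω).numZ, (R ω).z), (R ω).y))
    (fun ω (s : Sym2 PtLabel) => ((R ω).clock s, (R ω).coin s)) P

/-- The standing conditions on the augmentation `Z₀`: almost surely,
1. every point of `Z₀ ∪ Ψ` has, in bounded time, only finitely many connections to points of `Z₀`;
2. there is no infinite sequence of points of `Z₀ ∪ Ψ`, meeting `Z₀` infinitely often, whose
   successive connection times are decreasing. -/
structure IsAdmissibleAugmentation {Ω : Type*} [MeasurableSpace Ω] (P : Measure Ω) {d : ℕ}
    (f : ℝ → ℝ) (R : Ω → Realization d) : Prop where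
  finite_connections : ∀ᵐ ω ∂P, ∀ p ∈ (R ω).pts, ∀ t : ℝ≥0,
    {w ∈ (R ω).ptsZ | (R ω).T f p w ≤ t}.Finite
  no_decreasing_chain : ∀ᵐ ω ∂P, ¬ ∃ s : ℕ → PtLabel, (∀ n, s n ∈ (R ω).pts) ∧
    (∃ᶠ n in atTop, s n ∈ (R ω).ptsZ) ∧ StrictAnti (fun n => (R ω).T f (s n) (s (n + 1)))

/-! Follow the special points (zombies and antizombies) descending from `z`, and look only at their
meetings: connections of a special point to a regular one, alive in both systems. One outcome of the
coin kills the regular point in the system where the special point lives, which makes it special (a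
birth); the other kills the special point there, so that it is dead in both systems (a death). The
meeting and everything before it are determined by the points, the clocks and the earlier coins, so
this coin is fair given the past (`fair_step`). Hence one plus births minus deaths, observed at
successive meetings, is a martingale with steps ±1. A point dies in at most one meeting, and if it
is not `z` it was born in an earlier one, so the martingale is nonnegative (`Good.walk_nonneg`).
Such a process cannot move forever (`measure_forall_moves_eq_zero`), so there are finitely many
meetings (`ae_finite_meetings`). Every offspring except `z` is born in one of them, and this count
involves no time horizon.

For the dynamics to be well defined, the fate of a point must be computable from earlier
connections. This recursion runs along decreasing chains of connection times, so these must be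
finite; together with positivity, local finiteness and absence of ties this is `Good`, proved almost
surely in `ae_good`. A chain that meets the augmentation infinitely often is excluded by assumption,
and any other chain has a tail in `Ψ`. There a first moment count applies: in a time slice of length
ε before t, the expected number of self-avoiding paths of n connections from a bounded region is at
most a constant times (2ελt∫f)^n, which tends to 0 for small ε (`ae_no_long_path`). A decreasing
chain would end up in a single slice, hence in a finite component, and yet use infinitely many
connection times (`not_exists_strictAnti_of_paths`). -/

namespace Interaction

/-! ### Deterministic dynamics along well-founded connection times -/

variable {V : Type*}

/-- A symmetric family of connection times on the set `A` of points that is locally finite, free of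
ties and without infinite decreasing chains. -/
structure Good (T : V → V → ℝ≥0∞) (A : Set V) : Prop where
  symm : ∀ p q, T p q = T q p
  self : ∀ p, T p p = ∞
  pos : ∀ p ∈ A, ∀ q ∈ A, 0 < T p q
  finite : ∀ p ∈ A, ∀ t : ℝ≥0∞, t < ∞ → {q ∈ A | T p q ≤ t}.Finite
  noChain : ¬ ∃ s : ℕ → V, (∀ n, s n ∈ A) ∧ StrictAnti (fun n => T (s n) (s (n + 1)))
  inj : ∀ p ∈ A, ∀ q ∈ A, ∀ p' ∈ A, ∀ q' ∈ A, T p q = T p' q' → T p q ≠ ∞ → s(p, q) = s(p', q')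

/-- Death times of the system `S`. -/
def IsDeath (T : V → V → ℝ≥0∞) (I : V → V → Prop) (S : Set V) (e : V → ℝ≥0∞) : Prop :=
  ∀ p, (p ∈ S → e p = sInf {t | ∃ q ∈ S, t = T p q ∧ T p q ≤ e q ∧ I p q}) ∧ (p ∉ S → e p = 0)

/-- The `n`-th approximation of the statement that `q` is alive in the system `S` until its
connection to `p`. -/
def AliveApprox (T : V → V → ℝ≥0∞) (I : V → V → Prop) (S : Set V) : ℕ → V → V → Prop
  | 0, _, q => q ∈ S
  | n + 1, p, q => q ∈ S ∧ ∀ r, r ∈ S → T q r < T p q → I q r → ¬ AliveApprox T I S n q r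

/-- `q` is alive in the system `S` until its connection to `p`. -/
def Alive (T : V → V → ℝ≥0∞) (I : V → V → Prop) (S : Set V) (p q : V) : Prop :=
  ∃ N, ∀ n, N ≤ n → AliveApprox T I S n p q

/-- A special point `p` connects to a regular point `q`. -/
def Meet (T : V → V → ℝ≥0∞) (I : V → V → Prop) (A B : Set V) (p q : V) : Prop :=
  p ∈ A ∧ q ∈ A ∧ T p q ≠ ∞ ∧ ¬ (Alive T I B q p ↔ Alive T I A q p) ∧
    Alive T I B p q ∧ Alive T I A p q

/-- `q` is a child of the special point `p`. -/
def Child (T : V → V → ℝ≥0∞) (I : V → V → Prop) (A B : Set V) (p q : V) : Prop :=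
  Meet T I A B p q ∧ I q p

/-- The meetings of the offspring of `z` with regular points. -/
def meetings (T : V → V → ℝ≥0∞) (I : V → V → Prop) (A B : Set V) (z : V) : Set (V × V) :=
  {u | Meet T I A B u.1 u.2 ∧ Relation.ReflTransGen (Child T I A B) z u.1}

/-- `u` is the meeting number `n` (counted from `0`) of the offspring of `z`. -/
def IsNth (T : V → V → ℝ≥0∞) (I : V → V → Prop) (A B : Set V) (z : V) (n : ℕ) (u : V × V) : Prop :=
  u ∈ meetings T I A B z ∧
    {v | v ∈ meetings T I A B z ∧ T v.1 v.2 < T u.1 u.2}.encard = n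

variable {T : V → V → ℝ≥0∞} {I I' : V → V → Prop} {A B S : Set V} {e e' : V → ℝ≥0∞} {z : V}

/-- The predecessors of (p, q) are the pairs (q, r) with an earlier connection time, so a descending
sequence of pairs is a decreasing chain of points. -/
lemma Good.wf (hG : Good T A) :
    WellFounded (fun x y : A × A => x.1 = y.2 ∧ T x.1 x.2 < T y.1 y.2) := by
  rw [wellFounded_iff_isEmpty_descending_chain]
  constructor
  rintro ⟨s, hs⟩
  refine hG.noChain ⟨fun n => (s n).1, fun n => (s n).1.2, strictAnti_nat_of_succ_lt fun n => ?_⟩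
  have h1 := hs n
  have h2 := hs (n + 1)
  have e1 : ((s (n + 1)).1 : V) = (s n).2 := by rw [h1.1]
  have e2 : ((s (n + 1 + 1)).1 : V) = (s (n + 1)).2 := by rw [h2.1]
  show T (s (n + 1)).1 (s (n + 1 + 1)).1 < T (s n).1 (s (n + 1)).1
  rw [e2]
  refine h1.2.trans_eq ?_
  rw [e1]

/-- Induction along decreasing chains of connection times. -/
lemma Good.induct (hG : Good T A) (motive : V → V → Prop)
    (h : ∀ p ∈ A, ∀ q ∈ A, (∀ r ∈ A, T q r < T p q → motive q r) → motive p q) :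
    ∀ p ∈ A, ∀ q ∈ A, motive p q := by
  have key : ∀ x : A × A, motive x.1 x.2 := by
    intro x
    induction x using hG.wf.induction with
    | _ x ih =>
      exact h _ x.1.2 _ x.2.2 fun r hr hlt => ih (x.2, ⟨r, hr⟩) ⟨rfl, hlt⟩
  exact fun p hp q hq => key (⟨p, hp⟩, ⟨q, hq⟩)

/-- Only finitely many `r` connect to `q` before `p` does, so stabilisation of the approximations is
inherited along the induction. Defining `Alive` as an eventual value, not by well-founded recursion,
makes sense for every `T` and displays it as a countable combination of measurable conditions. -/
lemma Good.eventually_const (hG : Good T A) (hS : S ⊆ A) :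
    ∀ p ∈ A, ∀ q ∈ A, T p q ≠ ∞ →
      ∃ N, ∀ n, N ≤ n → (AliveApprox T I S n p q ↔ Alive T I S p q) := by
  have key : ∀ p ∈ A, ∀ q ∈ A, T p q ≠ ∞ →
      ∃ b : Prop, ∀ᶠ n in atTop, (AliveApprox T I S n p q ↔ b) := by
    refine hG.induct _ fun p hp q hq ih hT => ?_
    have hfin : {r ∈ A | T q r < T p q}.Finite :=
      (hG.finite q hq (T p q) hT.lt_top).subset fun r hr => ⟨hr.1, hr.2.le⟩
    have : ∀ r, ∃ b : Prop, r ∈ {r ∈ A | T q r < T p q} →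
        ∀ᶠ n in atTop, (AliveApprox T I S n q r ↔ b) := fun r => by
      by_cases hr : r ∈ {r ∈ A | T q r < T p q}
      · obtain ⟨b, hb⟩ := ih r hr.1 hr.2 (hr.2.trans hT.lt_top).ne
        exact ⟨b, fun _ => hb⟩
      · exact ⟨True, fun h => absurd h hr⟩
    choose b hb using this
    refine ⟨q ∈ S ∧ ∀ r, r ∈ S → T q r < T p q → I q r → ¬ b r, ?_⟩
    have h1 : ∀ᶠ n in atTop, ∀ r ∈ {r ∈ A | T q r < T p q}, (AliveApprox T I S n q r ↔ b r) :=
      (eventually_all_finite hfin).2 hb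
    obtain ⟨N, hN⟩ := eventually_atTop.1 h1
    refine eventually_atTop.2 ⟨N + 1, fun n hn => ?_⟩
    obtain ⟨m, rfl⟩ : ∃ m, n = m + 1 := ⟨n - 1, by omega⟩
    simp only [AliveApprox]
    refine and_congr_right fun _ => forall_congr' fun r => ?_
    refine forall_congr' fun hr => forall_congr' fun hlt => ?_
    rw [hN m (by omega) r ⟨hS hr, hlt⟩]
  intro p hp q hq hT
  obtain ⟨b, hb⟩ := key p hp q hq hT
  obtain ⟨N, hN⟩ := eventually_atTop.1 hb
  refine ⟨N, fun n hn => (hN n hn).trans ⟨fun h => ⟨N, fun k hk => (hN k hk).2 h⟩, ?_⟩⟩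
  rintro ⟨M, hM⟩
  exact (hN (max M N) (le_max_right _ _)).1 (hM _ (le_max_left _ _))

lemma Good.alive_iff (hG : Good T A) (hS : S ⊆ A) {p q : V} (hp : p ∈ A) (hq : q ∈ A)
    (hT : T p q ≠ ∞) :
    Alive T I S p q ↔ q ∈ S ∧ ∀ r, r ∈ S → T q r < T p q → I q r → ¬ Alive T I S q r := by
  have hfin : {r ∈ A | T q r < T p q}.Finite :=
    (hG.finite q hq (T p q) hT.lt_top).subset fun r hr => ⟨hr.1, hr.2.le⟩
  have h1 : ∀ᶠ n in atTop, ∀ r ∈ {r ∈ A | T q r < T p q},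
      (AliveApprox T I S n q r ↔ Alive T I S q r) :=
    (eventually_all_finite hfin).2 fun r hr => eventually_atTop.2
      (hG.eventually_const hS q hq r hr.1 (hr.2.trans hT.lt_top).ne)
  obtain ⟨N, hN⟩ := eventually_atTop.1 h1
  obtain ⟨M, hM⟩ := hG.eventually_const (I := I) hS p hp q hq hT
  rw [← hM (max M (N + 1)) (le_max_left _ _)]
  obtain ⟨m, hm⟩ : ∃ m, max M (N + 1) = m + 1 := ⟨max M (N + 1) - 1, by omega⟩
  rw [hm]
  simp only [AliveApprox]
  refine and_congr_right fun _ => forall_congr' fun r => ?_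
  refine forall_congr' fun hr => forall_congr' fun hlt => ?_
  rw [hN m (by omega) r ⟨hS hr, hlt⟩]

lemma le_death_iff (he : IsDeath T I S e) {p : V} (hp : p ∈ S) (x : ℝ≥0∞) :
    x ≤ e p ↔ ∀ q ∈ S, T p q ≤ e q → I p q → x ≤ T p q := by
  rw [(he p).1 hp, le_sInf_iff]
  constructor
  · intro h q hq h1 h2
    exact h _ ⟨q, hq, rfl, h1, h2⟩
  · rintro h _ ⟨q, hq, rfl, h1, h2⟩
    exact h q hq h1 h2

/-- Any death times obey the recursion `Good.alive_iff`, so induction along chains identifies them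
with `Alive`. For `q ∉ S` positivity of the connection times is needed, since then `e q = 0`. -/
lemma Good.alive_iff_le (hG : Good T A) (hS : S ⊆ A) (he : IsDeath T I S e) :
    ∀ p ∈ A, ∀ q ∈ A, T p q ≠ ∞ → (Alive T I S p q ↔ T p q ≤ e q) := by
  refine hG.induct _ fun p hp q hq ih hT => ?_
  rw [hG.alive_iff hS hp hq hT]
  by_cases hqS : q ∈ S
  · rw [le_death_iff he hqS]
    simp only [hqS, true_and]
    refine forall_congr' fun r => forall_congr' fun hr => ?_
    by_cases hlt : T q r < T p q
    · rw [ih r (hS hr) hlt (hlt.trans hT.lt_top).ne]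
      have : ¬ T p q ≤ T q r := not_le.2 hlt
      tauto
    · have : T p q ≤ T q r := not_lt.1 hlt
      tauto
  · have := hG.pos p hp q hq
    simp [hqS, (he q).2 hqS, this.ne']

lemma Good.existsUnique_death (hG : Good T A) (hS : S ⊆ A) : ∃! e, IsDeath T I S e := by
  classical
  -- Infinite connection times are left out: `Good.alive_iff` says nothing about them, and they do
  -- not affect the infimum.
  let e : V → ℝ≥0∞ := fun p => if p ∈ S then
    sInf {t | ∃ q ∈ S, t = T p q ∧ T p q ≠ ∞ ∧ Alive T I S p q ∧ I p q} else 0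
  have hle : ∀ p ∈ S, ∀ x, x ≤ e p ↔
      ∀ q ∈ S, T p q ≠ ∞ → Alive T I S p q → I p q → x ≤ T p q := by
    intro p hp x
    simp only [e, if_pos hp, le_sInf_iff]
    constructor
    · intro h q hq h1 h2 h3
      exact h _ ⟨q, hq, rfl, h1, h2, h3⟩
    · rintro h _ ⟨q, hq, rfl, h1, h2, h3⟩
      exact h q hq h1 h2 h3
  have hal : ∀ p ∈ A, ∀ q ∈ S, T p q ≠ ∞ → (Alive T I S p q ↔ T p q ≤ e q) := by
    intro p hp q hq hT
    rw [hG.alive_iff hS hp (hS hq) hT, hle q hq]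
    simp only [hq, true_and]
    refine forall_congr' fun r => forall_congr' fun hr => ?_
    by_cases hlt : T q r < T p q
    · have : ¬ T p q ≤ T q r := not_le.2 hlt
      have := (hlt.trans hT.lt_top).ne
      tauto
    · have : T p q ≤ T q r := not_lt.1 hlt
      tauto
  refine ⟨e, fun p => ⟨fun hp => ?_, fun hp => if_neg hp⟩, fun e₁ he₁ => ?_⟩
  · refine eq_of_forall_le_iff fun x => ?_
    rw [hle p hp, le_sInf_iff]
    constructor
    · rintro h _ ⟨q, hq, rfl, h1, h2⟩
      by_cases hT : T p q = ∞
      · simp [hT]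
      · exact h q hq hT ((hal p (hS hp) q hq hT).2 h1) h2
    · intro h q hq hT h1 h2
      exact h _ ⟨q, hq, rfl, (hal p (hS hp) q hq hT).1 h1, h2⟩
  · funext p
    by_cases hp : p ∈ S
    · refine eq_of_forall_le_iff fun x => ?_
      rw [hle p hp, le_death_iff he₁ hp]
      refine forall_congr' fun q => forall_congr' fun hq => ?_
      by_cases hT : T p q = ∞
      · simp [hT]
      · rw [hG.alive_iff_le hS he₁ p (hS hp) q (hS hq) hT]
        tauto
    · rw [(he₁ p).2 hp]
      exact (if_neg hp).symm

/-! ### Dependence on the coins -/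

/-- The recursion at `T p q` consults strictly earlier connections only. The contrast between `<` in
the hypothesis and `≤` in the conclusion is what later frees a meeting from its own coin. -/
lemma Good.alive_congr (hG : Good T A) (hS : S ⊆ A) {t : ℝ≥0∞}
    (hI : ∀ p ∈ A, ∀ q ∈ A, T p q < t → (I p q ↔ I' p q)) :
    ∀ p ∈ A, ∀ q ∈ A, T p q ≠ ∞ → T p q ≤ t → (Alive T I S p q ↔ Alive T I' S p q) := by
  refine hG.induct _ fun p hp q hq ih hT ht => ?_
  rw [hG.alive_iff hS hp hq hT, hG.alive_iff hS hp hq hT]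
  refine and_congr_right fun _ => forall_congr' fun r => ?_
  refine forall_congr' fun hr => forall_congr' fun hlt => ?_
  rw [ih r (hS hr) hlt (hlt.trans hT.lt_top).ne (hlt.le.trans ht),
    hI q hq r (hS hr) (hlt.trans_le ht)]

lemma Good.meet_congr (hG : Good T A) (hB : B ⊆ A) {t : ℝ≥0∞}
    (hI : ∀ p ∈ A, ∀ q ∈ A, T p q < t → (I p q ↔ I' p q)) {p q : V} (ht : T p q ≤ t) :
    Meet T I A B p q ↔ Meet T I' A B p q := by
  unfold Meet
  refine and_congr_right fun hp => and_congr_right fun hq => and_congr_right fun hT => ?_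
  have hT' : T q p ≠ ∞ := hG.symm p q ▸ hT
  have ht' : T q p ≤ t := hG.symm p q ▸ ht
  rw [hG.alive_congr hB hI p hp q hq hT ht, hG.alive_congr subset_rfl hI p hp q hq hT ht,
    hG.alive_congr hB hI q hq p hp hT' ht', hG.alive_congr subset_rfl hI q hq p hp hT' ht']

/-- A child is alive in both systems until the connection that turns it special, so it cannot act as
a special point at or before that time. -/
lemma Good.lt_of_child (hG : Good T A) (hB : B ⊆ A) {r p q : V} (h : Child T I A B r p)
    (h' : Meet T I A B p q) : T r p < T p q := by
  obtain ⟨e, he, -⟩ := hG.existsUnique_death (I := I) hB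
  obtain ⟨e', he', -⟩ := hG.existsUnique_death (I := I) (subset_refl A)
  obtain ⟨⟨hr, hp, hT, -, h1, h2⟩, -⟩ := h
  obtain ⟨-, hq, hT', h3, -⟩ := h'
  by_contra! hle
  rw [hG.alive_iff_le hB he r hr p hp hT] at h1
  rw [hG.alive_iff_le subset_rfl he' r hr p hp hT] at h2
  rw [hG.symm] at hT'
  rw [hG.alive_iff_le hB he q hq p hp hT', hG.alive_iff_le subset_rfl he' q hq p hp hT',
    ← hG.symm p q] at h3
  exact h3 (iff_of_true (hle.trans h1) (hle.trans h2))

lemma Good.mem_meetings_congr_aux (hG : Good T A) (hB : B ⊆ A) {t : ℝ≥0∞}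
    (hI : ∀ p ∈ A, ∀ q ∈ A, T p q < t → (I p q ↔ I' p q)) {p : V}
    (h : Relation.ReflTransGen (Child T I A B) z p) :
    ∀ q, Meet T I A B p q → T p q ≤ t → Relation.ReflTransGen (Child T I' A B) z p := by
  induction h with
  | refl => exact fun _ _ _ => .refl
  | @tail r p _ hrp ih =>
    intro q hm ht
    have hlt := hG.lt_of_child hB hrp hm
    refine (ih p hrp.1 (hlt.le.trans ht)).tail ⟨?_, ?_⟩
    · exact (hG.meet_congr hB hI (hlt.le.trans ht)).1 hrp.1
    · refine (hI p hrp.1.2.1 r hrp.1.1 ?_).1 hrp.2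
      rw [hG.symm]
      exact hlt.trans_le ht

lemma Good.mem_meetings_congr (hG : Good T A) (hB : B ⊆ A) {t : ℝ≥0∞}
    (hI : ∀ p ∈ A, ∀ q ∈ A, T p q < t → (I p q ↔ I' p q)) {u : V × V} (ht : T u.1 u.2 ≤ t) :
    u ∈ meetings T I A B z ↔ u ∈ meetings T I' A B z := by
  constructor
  · rintro ⟨h1, h2⟩
    exact ⟨(hG.meet_congr hB hI ht).1 h1, hG.mem_meetings_congr_aux hB hI h2 _ h1 ht⟩
  · rintro ⟨h1, h2⟩
    have hI2 : ∀ p ∈ A, ∀ q ∈ A, T p q < t → (I' p q ↔ I p q) :=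
      fun p hp q hq h => (hI p hp q hq h).symm
    exact ⟨(hG.meet_congr hB hI2 ht).1 h1, hG.mem_meetings_congr_aux hB hI2 h2 _ h1 ht⟩

lemma Good.isNth_congr (hG : Good T A) (hB : B ⊆ A) {t : ℝ≥0∞}
    (hI : ∀ p ∈ A, ∀ q ∈ A, T p q < t → (I p q ↔ I' p q)) {n : ℕ} {u : V × V}
    (ht : T u.1 u.2 ≤ t) :
    IsNth T I A B z n u ↔ IsNth T I' A B z n u := by
  unfold IsNth
  rw [hG.mem_meetings_congr hB hI ht]
  have : {v | v ∈ meetings T I A B z ∧ T v.1 v.2 < T u.1 u.2} =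
      {v | v ∈ meetings T I' A B z ∧ T v.1 v.2 < T u.1 u.2} := by
    ext v
    refine and_congr_left fun h => hG.mem_meetings_congr hB hI (h.le.trans ht)
  rw [this]

/-! ### The chronological enumeration of the meetings -/

/-- Without ties the unordered pairs agree, and the roles cannot be exchanged because a regular
point is not special at the same time. -/
lemma Good.meet_unique (hG : Good T A) {u v : V × V} (hu : Meet T I A B u.1 u.2)
    (hv : Meet T I A B v.1 v.2) (h : T u.1 u.2 = T v.1 v.2) : u = v := by
  have := hG.inj _ hu.1 _ hu.2.1 _ hv.1 _ hv.2.1 h hu.2.2.1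
  rw [Sym2.eq_iff] at this
  rcases this with ⟨h1, h2⟩ | ⟨h1, h2⟩
  · exact Prod.ext h1 h2
  · exfalso
    have h3 := hu.2.2.2.1
    rw [h1, h2] at h3
    exact h3 (iff_of_true hv.2.2.2.2.1 hv.2.2.2.2.2)

lemma Good.isNth_unique (hG : Good T A) {n : ℕ} {u v : V × V} (hu : IsNth T I A B z n u)
    (hv : IsNth T I A B z n v) : u = v := by
  have key : ∀ u v, IsNth T I A B z n u → IsNth T I A B z n v →
      ¬ T u.1 u.2 < T v.1 v.2 := by
    intro u v hu hv hlt
    have hfin : {w | w ∈ meetings T I A B z ∧ T w.1 w.2 < T v.1 v.2}.Finite :=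
      Set.finite_of_encard_eq_coe hv.2
    have hss : {w | w ∈ meetings T I A B z ∧ T w.1 w.2 < T u.1 u.2} ⊂
        {w | w ∈ meetings T I A B z ∧ T w.1 w.2 < T v.1 v.2} :=
      ⟨fun w hw => ⟨hw.1, hw.2.trans hlt⟩, fun h => lt_irrefl _ (h ⟨hu.1, hlt⟩).2⟩
    have := (hfin.subset hss.1).encard_lt_encard hss
    rw [hu.2, hv.2] at this
    exact lt_irrefl _ this
  exact hG.meet_unique hu.1.1 hv.1.1
    (le_antisymm (not_lt.1 (key _ _ hv hu)) (not_lt.1 (key _ _ hu hv)))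

/-- Going back along the ancestry of a meeting outside `F` only decreases times, and leads to a
meeting outside `F` whose special point is `z` or was born in a meeting of `F`. By local finiteness
only finitely many such candidates precede a given time, although the meetings before that time are
not yet known to be finite in number. -/
lemma Good.exists_min (hG : Good T A) (hB : B ⊆ A) {F : Finset (V × V)}
    (hne : (meetings T I A B z \ F).Nonempty) :
    ∃ u ∈ meetings T I A B z \ F, ∀ v ∈ meetings T I A B z \ F, T u.1 u.2 ≤ T v.1 v.2 := by
  classical
  obtain ⟨w₀, hw₀⟩ := hne
  set Q : Set V := insert z (Prod.snd '' (F : Set (V × V)))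
  have hQ : Q.Finite := (F.finite_toSet.image _).insert z
  have key : ∀ w ∈ meetings T I A B z \ F, ∃ c ∈ meetings T I A B z \ F,
      c.1 ∈ Q ∧ T c.1 c.2 ≤ T w.1 w.2 := by
    rintro ⟨p, q⟩ ⟨⟨hm, ho⟩, hF⟩
    dsimp only at hm ho
    induction ho generalizing q with
    | refl => exact ⟨(z, q), ⟨⟨hm, .refl⟩, hF⟩, Set.mem_insert _ _, le_rfl⟩
    | @tail r p hr hrp ih =>
      have hlt := hG.lt_of_child hB hrp hm
      by_cases hF' : (r, p) ∈ F
      · exact ⟨(p, q), ⟨⟨hm, hr.tail hrp⟩, hF⟩,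
          Set.mem_insert_of_mem _ ⟨(r, p), hF', rfl⟩, le_rfl⟩
      · obtain ⟨c, hc, hcQ, hcT⟩ := ih p hF' hrp.1
        exact ⟨c, hc, hcQ, hcT.trans hlt.le⟩
  set C : Set (V × V) := {c | c ∈ meetings T I A B z \ F ∧ c.1 ∈ Q ∧ T c.1 c.2 ≤ T w₀.1 w₀.2}
  have hC : C.Finite := by
    refine Set.Finite.subset (s := ⋃ p ∈ {p ∈ Q | p ∈ A}, (fun q => (p, q)) ''
      {q ∈ A | T p q ≤ T w₀.1 w₀.2}) ?_ ?_
    · refine (hQ.subset fun p hp => hp.1).biUnion fun p hp => ?_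
      exact (hG.finite p hp.2 _ (lt_top_iff_ne_top.2 hw₀.1.1.2.2.1)).image _
    · rintro ⟨p, q⟩ ⟨h1, h2, h3⟩
      simp only [Set.mem_iUnion]
      exact ⟨p, ⟨h2, h1.1.1.1⟩, q, ⟨h1.1.1.2.1, h3⟩, rfl⟩
  obtain ⟨c₀, hc₀, hcQ₀, hcT₀⟩ := key w₀ hw₀
  obtain ⟨u, hu, hmin⟩ := Set.exists_min_image C (fun c => T c.1 c.2) hC ⟨c₀, hc₀, hcQ₀, hcT₀⟩
  refine ⟨u, hu.1, fun v hv => ?_⟩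
  obtain ⟨c, hc, hcQ, hcT⟩ := key v hv
  by_cases hle : T c.1 c.2 ≤ T w₀.1 w₀.2
  · exact (hmin c ⟨hc, hcQ, hle⟩).trans hcT
  · exact (hu.2.2.trans (not_le.1 hle).le).trans hcT

/-- The earliest remaining meeting is removed repeatedly. The numbering need not exhaust the
meetings; it suffices that every finite rank occurs. -/
lemma Good.exists_isNth (hG : Good T A) (hB : B ⊆ A) (hinf : (meetings T I A B z).Infinite)
    (n : ℕ) : ∃ u, IsNth T I A B z n u := by
  classical
  have key : ∀ n : ℕ, ∃ F : Finset (V × V), F.card = n ∧ ↑F ⊆ meetings T I A B z ∧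
      ∀ u ∈ F, ∀ v ∈ meetings T I A B z \ F, T u.1 u.2 < T v.1 v.2 := by
    intro n
    induction n with
    | zero => exact ⟨∅, rfl, by simp, by simp⟩
    | succ n ih =>
      obtain ⟨F, hc, hF, hlt⟩ := ih
      obtain ⟨u, hu, hmin⟩ := hG.exists_min hB (hinf.sdiff F.finite_toSet).nonempty
      refine ⟨insert u F, by rw [Finset.card_insert_of_notMem hu.2, hc], ?_, ?_⟩
      · rw [Finset.coe_insert]
        exact Set.insert_subset hu.1 hF
      · intro w hw v hv
        have hv' : v ∈ meetings T I A B z \ F := ⟨hv.1, fun h => hv.2 (by simp [h])⟩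
        rcases Finset.mem_insert.1 hw with rfl | hw
        · refine lt_of_le_of_ne (hmin v hv') fun h => hv.2 ?_
          rw [hG.meet_unique hu.1.1 hv.1.1 h]
          simp
        · exact hlt w hw v hv'
  obtain ⟨F, hc, hF, hlt⟩ := key n
  obtain ⟨u, hu, hmin⟩ := hG.exists_min hB (hinf.sdiff F.finite_toSet).nonempty
  refine ⟨u, hu.1, ?_⟩
  have : {v | v ∈ meetings T I A B z ∧ T v.1 v.2 < T u.1 u.2} = F := by
    ext v
    constructor
    · rintro ⟨h1, h2⟩
      by_contra h
      exact absurd h2 (not_lt.2 (hmin v ⟨h1, h⟩))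
    · exact fun h => ⟨hF h, hlt v h u hu⟩
  rw [this, Set.encard_coe_eq_coe_finsetCard, hc]

/-! ### The number of births dominates the number of deaths -/

/-- At such a meeting `p` dies in the one system where it is still alive, so `T p q` is the larger
of its two death times. Absence of ties then determines `q`. -/
lemma Good.death_unique (hG : Good T A) (hB : B ⊆ A) {p q q' : V} (h : Meet T I A B p q)
    (hI : I p q) (h' : Meet T I A B p q') (hI' : I p q') : q = q' := by
  obtain ⟨e, he, -⟩ := hG.existsUnique_death (I := I) hB
  obtain ⟨e', he', -⟩ := hG.existsUnique_death (I := I) (subset_refl A)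
  have key : ∀ q, Meet T I A B p q → I p q →
      (e' p = T p q ∧ e p < T p q) ∨ (e p = T p q ∧ e' p < T p q) := by
    rintro q ⟨hp, hq, hT, hx, h1, h2⟩ hI
    rw [hG.alive_iff_le hB he p hp q hq hT] at h1
    rw [hG.alive_iff_le subset_rfl he' p hp q hq hT] at h2
    have hT' := hT
    rw [hG.symm] at hT'
    rw [hG.alive_iff_le hB he q hq p hp hT', hG.alive_iff_le subset_rfl he' q hq p hp hT',
      ← hG.symm p q] at hx
    by_cases h3 : T p q ≤ e' p
    · refine .inl ⟨le_antisymm ?_ h3, not_le.1 (by tauto)⟩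
      exact (le_death_iff he' hp _).1 le_rfl q hq h2 hI
    · have h4 : T p q ≤ e p := by tauto
      have hpB : p ∈ B := by
        by_contra hpB
        rw [(he p).2 hpB] at h4
        exact (hG.pos p hp q hq).not_ge h4
      have hqB : q ∈ B := by
        by_contra hqB
        rw [(he q).2 hqB] at h1
        exact (hG.pos p hp q hq).not_ge h1
      exact .inr ⟨le_antisymm ((le_death_iff he hpB _).1 le_rfl q hqB h1 hI) h4, not_le.1 h3⟩
  have hTT : T p q = T p q' := by
    rcases key q h hI with ⟨h1, h2⟩ | ⟨h1, h2⟩ <;> rcases key q' h' hI' with ⟨h3, h4⟩ | ⟨h3, h4⟩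
    · exact h1.symm.trans h3
    · rw [h1] at h4; rw [h3] at h2; exact absurd h2 h4.not_gt
    · rw [h1] at h4; rw [h3] at h2; exact absurd h2 h4.not_gt
    · exact h1.symm.trans h3
  exact congrArg Prod.snd (hG.meet_unique (u := (p, q)) (v := (p, q')) h h' hTT)

lemma exists_isNth_lt {n : ℕ} {u v : V × V}
    (hu : IsNth T I A B z n u) (hv : v ∈ meetings T I A B z) (hlt : T v.1 v.2 < T u.1 u.2) :
    ∃ m < n, IsNth T I A B z m v := by
  have hfin : {w | w ∈ meetings T I A B z ∧ T w.1 w.2 < T u.1 u.2}.Finite :=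
    Set.finite_of_encard_eq_coe hu.2
  have hss : {w | w ∈ meetings T I A B z ∧ T w.1 w.2 < T v.1 v.2} ⊂
      {w | w ∈ meetings T I A B z ∧ T w.1 w.2 < T u.1 u.2} :=
    ⟨fun w hw => ⟨hw.1, hw.2.trans hlt⟩, fun h => lt_irrefl _ (h ⟨hv, hlt⟩).2⟩
  have h1 := (hfin.subset hss.1).encard_lt_encard hss
  rw [hu.2] at h1
  obtain ⟨m, hm⟩ := ENat.ne_top_iff_exists.1 (h1.trans_le le_top).ne
  rw [← hm] at h1
  exact ⟨m, by exact_mod_cast h1, hv, hm.symm⟩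

open Classical in
/-- One plus the number of births minus the number of deaths in the first `n` meetings. -/
noncomputable def walk (T : V → V → ℝ≥0∞) (I : V → V → Prop) (A B : Set V) (z : V) (n : ℕ) : ℤ :=
  1 + ∑ k ∈ Finset.range n, ((if ∃ u : V × V, IsNth T I A B z k u ∧ I u.2 u.1 then 1 else 0) -
    (if ∃ u : V × V, IsNth T I A B z k u ∧ ¬ I u.2 u.1 then 1 else 0))

/-- A point that dies in a meeting is `z` or the newborn of an earlier meeting, and it dies only
once. So deaths inject into births together with `z`. -/
lemma Good.walk_nonneg (hG : Good T A) (hB : B ⊆ A)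
    (hI : ∀ p q, p ≠ q → (I p q ↔ ¬ I q p)) (n : ℕ) : 0 ≤ walk T I A B z n := by
  classical
  set Bs := (Finset.range n).filter fun k => ∃ u : V × V, IsNth T I A B z k u ∧ I u.2 u.1
  set Ds := (Finset.range n).filter fun k => ∃ u : V × V, IsNth T I A B z k u ∧ ¬ I u.2 u.1
  have hw : walk T I A B z n = 1 + ((Bs.card : ℤ) - Ds.card) := by
    rw [walk, Finset.sum_sub_distrib, Finset.sum_boole, Finset.sum_boole]
  suffices h : Ds.card ≤ Bs.card + 1 by
    rw [hw]; omega
  have hb : ∀ k, ∃ u : V × V, k ∈ Bs → IsNth T I A B z k u ∧ I u.2 u.1 := fun k => by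
    by_cases hk : k ∈ Bs
    · obtain ⟨u, hu⟩ := (Finset.mem_filter.1 hk).2
      exact ⟨u, fun _ => hu⟩
    · exact ⟨(z, z), fun h => absurd h hk⟩
  have hd : ∀ k, ∃ u : V × V, k ∈ Ds → IsNth T I A B z k u ∧ ¬ I u.2 u.1 := fun k => by
    by_cases hk : k ∈ Ds
    · obtain ⟨u, hu⟩ := (Finset.mem_filter.1 hk).2
      exact ⟨u, fun _ => hu⟩
    · exact ⟨(z, z), fun h => absurd h hk⟩
  choose b hb using hb
  choose d hd using hd
  have hdI : ∀ k ∈ Ds, I (d k).1 (d k).2 := fun k hk => by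
    refine (hI _ _ fun h => ?_).2 (hd k hk).2
    have := (hd k hk).1.1.1.2.2.1
    rw [h, hG.self] at this
    exact this rfl
  calc Ds.card = (Ds.image fun k => (d k).1).card := by
        refine (Finset.card_image_of_injOn fun k hk l hl hkl => ?_).symm
        have h1 := hd k hk
        have h2 := hd l hl
        have hkl : (d k).1 = (d l).1 := hkl
        have h3 := hG.death_unique hB h1.1.1.1 (hdI k hk) (hkl ▸ h2.1.1.1) (hkl ▸ hdI l hl)
        have h4 : d k = d l := Prod.ext hkl h3
        have h5 := h1.1.2
        rw [h4, h2.1.2] at h5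
        exact_mod_cast h5.symm
    _ ≤ (insert z (Bs.image fun k => (b k).2)).card := by
        refine Finset.card_le_card fun p hp => ?_
        obtain ⟨k, hk, rfl⟩ := Finset.mem_image.1 hp
        have h1 := (hd k hk).1
        rcases Relation.ReflTransGen.cases_tail h1.1.2 with h | ⟨r, hr, hrp⟩
        · exact Finset.mem_insert.2 (.inl h)
        · have hlt := hG.lt_of_child hB hrp h1.1.1
          obtain ⟨m, hm, hnth⟩ := exists_isNth_lt h1 (v := (r, (d k).1)) ⟨hrp.1, hr⟩ hlt
          have hmB : m ∈ Bs := Finset.mem_filter.2 ⟨Finset.mem_range.2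
            (hm.trans (Finset.mem_range.1 (Finset.mem_filter.1 hk).1)), _, hnth, hrp.2⟩
          refine Finset.mem_insert_of_mem (Finset.mem_image.2 ⟨m, hmB, ?_⟩)
          rw [hG.isNth_unique (hb m hmB).1 hnth]
    _ ≤ _ := (Finset.card_insert_le _ _).trans (Nat.add_le_add_right Finset.card_image_le 1)

/-- The walk at `n` sums over the ranks `k < n`, whose meetings come strictly before `u`; neither
they nor their coins see a coin at the time of `u` or later. -/
lemma Good.walk_congr (hG : Good T A) (hB : B ⊆ A) {u : V × V} {n : ℕ}
    (hu : IsNth T I A B z n u)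
    (hI : ∀ p ∈ A, ∀ q ∈ A, T p q < T u.1 u.2 → (I p q ↔ I' p q)) :
    walk T I A B z n = walk T I' A B z n := by
  classical
  have hu' := (hG.isNth_congr hB hI le_rfl).1 hu
  have hex : ∀ (J J' : V → V → Prop), IsNth T J A B z n u → IsNth T J' A B z n u →
      (∀ p ∈ A, ∀ q ∈ A, T p q < T u.1 u.2 → (J p q ↔ J' p q)) → ∀ k < n, ∀ v,
      IsNth T J A B z k v → IsNth T J' A B z k v ∧ (J v.2 v.1 ↔ J' v.2 v.1) := by
    intro J J' hJ hJ' h k hk v hv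
    have hlt : T v.1 v.2 < T u.1 u.2 := by
      by_contra! hle
      rcases hle.lt_or_eq with hlt | heq
      · obtain ⟨m, hm, h1⟩ := exists_isNth_lt hv hJ.1 hlt
        have h2 := hJ.2.symm.trans h1.2
        have : n = m := by exact_mod_cast h2
        omega
      · have := hG.meet_unique hJ.1.1 hv.1.1 heq
        subst this
        have : n = k := by exact_mod_cast hJ.2.symm.trans hv.2
        omega
    refine ⟨(hG.isNth_congr hB h hlt.le).1 hv, h _ hv.1.1.2.1 _ hv.1.1.1 ?_⟩
    rwa [hG.symm]
  have hI' : ∀ p ∈ A, ∀ q ∈ A, T p q < T u.1 u.2 → (I' p q ↔ I p q) :=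
    fun p hp q hq h => (hI p hp q hq h).symm
  have h1 := hex I I' hu hu' hI
  have h2 := hex I' I hu' hu hI'
  unfold walk
  congr 1
  refine Finset.sum_congr rfl fun k hk => ?_
  have hk := Finset.mem_range.1 hk
  have e1 : (∃ u : V × V, IsNth T I A B z k u ∧ I u.2 u.1) ↔
      ∃ u : V × V, IsNth T I' A B z k u ∧ I' u.2 u.1 := by
    constructor
    · rintro ⟨v, hv, hv'⟩
      exact ⟨v, (h1 k hk v hv).1, (h1 k hk v hv).2.1 hv'⟩
    · rintro ⟨v, hv, hv'⟩
      exact ⟨v, (h2 k hk v hv).1, (h2 k hk v hv).2.1 hv'⟩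
  have e2 : (∃ u : V × V, IsNth T I A B z k u ∧ ¬ I u.2 u.1) ↔
      ∃ u : V × V, IsNth T I' A B z k u ∧ ¬ I' u.2 u.1 := by
    constructor
    · rintro ⟨v, hv, hv'⟩
      exact ⟨v, (h1 k hk v hv).1, fun h => hv' ((h1 k hk v hv).2.2 h)⟩
    · rintro ⟨v, hv, hv'⟩
      exact ⟨v, (h2 k hk v hv).1, fun h => hv' ((h2 k hk v hv).2.2 h)⟩
  simp only [e1, e2]

end Interaction

/-! ### Offspring families are controlled by meetings -/

namespace Realization

open Interaction

variable {d : ℕ}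

/-- Being turned special is a `Child` relation, so each offspring is `z` or the second point of a
meeting; the bound does not depend on `t`. -/
lemma family_finite {c : Realization d} {f : ℝ → ℝ} {e e' : PtLabel → ℝ≥0∞} {z : PtLabel}
    (hG : Good (c.T f) c.pts) (he : c.IsDeathTimes f c.ptsPsi e)
    (he' : c.IsDeathTimes f c.pts e')
    (hfin : (meetings (c.T f) c.I c.pts c.ptsPsi z).Finite) (t : ℝ≥0∞) :
    (c.family f e e' t z).Finite := by
  have hB : c.ptsPsi ⊆ c.pts := Set.subset_union_right
  have hchild : ∀ p q, c.TurnsSpecial f e e' p q → Child (c.T f) c.I c.pts c.ptsPsi p q := by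
    have mem : ∀ p, 0 < e p → p ∈ c.ptsPsi := fun p h => by
      by_contra hp
      exact h.ne' ((he p).2 hp)
    have mem' : ∀ p, 0 < e' p → p ∈ c.pts := fun p h => by
      by_contra hp
      exact h.ne' ((he' p).2 hp)
    rintro p q ⟨hI, ⟨h1, h2, h3, h4⟩ | ⟨h1, h2, h3, h4⟩⟩
    · have hT := (h4.trans_le le_top).ne
      have hT' : c.T f q p ≠ ∞ := hG.symm p q ▸ hT
      have hp := mem' p ((zero_le.trans_lt h1).trans_le h2)
      have hq := hB (mem q (zero_le.trans_lt h4))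
      refine ⟨⟨hp, hq, hT, ?_, ?_, ?_⟩, hI⟩
      · rw [hG.alive_iff_le hB he q hq p hp hT', hG.alive_iff_le subset_rfl he' q hq p hp hT',
          hG.symm q p]
        exact fun h => h1.not_ge (h.2 h2)
      · exact (hG.alive_iff_le hB he p hp q hq hT).2 h4.le
      · exact (hG.alive_iff_le subset_rfl he' p hp q hq hT).2 h3.ge
    · have hT := (h4.trans_le le_top).ne
      have hT' : c.T f q p ≠ ∞ := hG.symm p q ▸ hT
      have hp := hB (mem p ((zero_le.trans_lt h1).trans_le h2))
      have hq := mem' q (zero_le.trans_lt h4)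
      refine ⟨⟨hp, hq, hT, ?_, ?_, ?_⟩, hI⟩
      · rw [hG.alive_iff_le hB he q hq p hp hT', hG.alive_iff_le subset_rfl he' q hq p hp hT',
          hG.symm q p]
        exact fun h => h1.not_ge (h.1 h2)
      · exact (hG.alive_iff_le hB he p hp q hq hT).2 h3.ge
      · exact (hG.alive_iff_le subset_rfl he' p hp q hq hT).2 h4.le
  refine ((hfin.image Prod.snd).insert z).subset ?_
  intro p hp
  simp only [family, Set.mem_iUnion] at hp
  obtain ⟨t, -, hp⟩ := hp
  have ho : c.Originates f e e' z p := by
    rcases hp with hp | hp <;> exact hp.1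
  have ho' := Relation.ReflTransGen.mono hchild _ _ ho
  rcases Relation.ReflTransGen.cases_tail ho' with h | ⟨r, hr, hrp⟩
  · exact .inl h
  · exact .inr ⟨(r, p), ⟨hrp.1, hr⟩, rfl⟩

end Realization

/-! ### An integer valued nonnegative martingale with steps `±1` is eventually constant -/

section Walk

variable {Ω : Type*} [MeasurableSpace Ω] {P : Measure Ω} [IsProbabilityMeasure P]

/-- A nonnegative integer valued process which moves up on `U n` and down on `D n`, both being
equally likely given the present, almost surely stops moving. -/
lemma measure_forall_moves_eq_zero {X : ℕ → Ω → ℕ} {U D : ℕ → Set Ω}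
    (hX : ∀ n, Measurable (X n)) (hU : ∀ n, MeasurableSet (U n)) (hD : ∀ n, MeasurableSet (D n))
    (h0 : ∀ᵐ ω ∂P, X 0 ω = 1)
    (hup : ∀ n, ∀ᵐ ω ∂P, ω ∈ U n → X (n + 1) ω = X n ω + 1 ∧ ω ∉ D n)
    (hdown : ∀ n, ∀ᵐ ω ∂P, ω ∈ D n → X n ω = X (n + 1) ω + 1)
    (hstay : ∀ n, ∀ᵐ ω ∂P, ω ∉ U n → ω ∉ D n → X (n + 1) ω = X n ω)
    (hfair : ∀ n (φ : ℕ → ℝ≥0∞),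
      ∫⁻ ω, (U n).indicator (fun ω => φ (X n ω)) ω ∂P =
        ∫⁻ ω, (D n).indicator (fun ω => φ (X n ω)) ω ∂P) :
    P (⋂ n, (U n ∪ D n)) = 0 := by
  have hm : ∀ n (φ : ℕ → ℝ≥0∞), Measurable fun ω => φ (X n ω) :=
    fun n φ => (measurable_of_countable φ).comp (hX n)
  -- Martingale property: up and down moves have the same probability. Moving the down steps to the
  -- left side avoids subtraction.
  have hmean : ∀ n, ∫⁻ ω, (X n ω : ℝ≥0∞) ∂P = 1 := by
    intro n
    induction n with
    | zero =>
      rw [lintegral_congr_ae (g := fun _ => (1 : ℝ≥0∞)) (h0.mono fun ω h => by simp [h])]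
      simp
    | succ n ih =>
      have hDU : P (U n) = P (D n) := by
        have := hfair n (fun _ => 1)
        simpa [lintegral_indicator, hU, hD] using this
      have h1 : ∫⁻ ω, ((X (n + 1) ω : ℝ≥0∞) + (D n).indicator 1 ω) ∂P =
          ∫⁻ ω, ((X n ω : ℝ≥0∞) + (U n).indicator 1 ω) ∂P := by
        refine lintegral_congr_ae ?_
        filter_upwards [hup n, hdown n, hstay n] with ω h1 h2 h3
        by_cases hu : ω ∈ U n
        · simp [hu, h1 hu]
        · by_cases hd : ω ∈ D n
          · simp [hu, hd, h2 hd]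
          · simp [hu, hd, h3 hu hd]
      rw [lintegral_add_right _ (measurable_one.indicator (hD n)),
        lintegral_add_right _ (measurable_one.indicator (hU n)), ih,
        lintegral_indicator_one (hD n), lintegral_indicator_one (hU n), hDU] at h1
      exact (ENNReal.add_left_inj (measure_ne_top P _)).1 h1
  -- A bounded convex function: an up move removes half of `ψ`, a down move adds all of it. Fairness
  -- makes its mean grow by half of `β n` at each step, so `β` is summable and tends to 0.
  set ψ : ℕ → ℝ≥0∞ := fun x => 2⁻¹ ^ x
  have hψ1 : ∀ x, ψ x ≤ 1 := fun x => pow_le_one₀ zero_le (by simp)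
  set β : ℕ → ℝ≥0∞ := fun n => ∫⁻ ω, (U n).indicator (fun ω => ψ (X n ω)) ω ∂P
  have hβ : ∀ n, β n ≤ 1 := fun n => by
    calc β n ≤ ∫⁻ _, 1 ∂P := lintegral_mono fun ω =>
          (Set.indicator_le_self _ _ _).trans (hψ1 _)
      _ = 1 := by simp
  have hsum : ∀ n, ∑ k ∈ Finset.range n, 2⁻¹ * β k ≤ ∫⁻ ω, ψ (X n ω) ∂P := by
    intro n
    induction n with
    | zero => simp
    | succ n ih =>
      have h1 : ∫⁻ ω, (ψ (X (n + 1) ω) + 2⁻¹ * (U n).indicator (fun ω => ψ (X n ω)) ω) ∂P =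
          ∫⁻ ω, (ψ (X n ω) + (D n).indicator (fun ω => ψ (X n ω)) ω) ∂P := by
        refine lintegral_congr_ae ?_
        filter_upwards [hup n, hdown n, hstay n] with ω h1 h2 h3
        by_cases hu : ω ∈ U n
        · simp only [hu, Set.indicator_of_mem, h1 hu, Set.indicator_of_notMem, not_false_eq_true,
            add_zero, ψ, pow_succ]
          rw [mul_comm, ← add_mul, ENNReal.inv_two_add_inv_two, one_mul]
        · by_cases hd : ω ∈ D n
          · simp only [hu, hd, Set.indicator_of_mem, Set.indicator_of_notMem, not_false_eq_true,
              mul_zero, add_zero, ψ]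
            rw [h2 hd, pow_succ, ← mul_add, ENNReal.inv_two_add_inv_two, mul_one]
          · simp [hu, hd, h3 hu hd]
      rw [lintegral_add_right _ (((hm n ψ).indicator (hU n)).const_mul _),
        lintegral_add_right _ ((hm n ψ).indicator (hD n)), ← hfair n ψ,
        lintegral_const_mul _ ((hm n ψ).indicator (hU n))] at h1
      have h2 : β n = 2⁻¹ * β n + 2⁻¹ * β n := by
        rw [← add_mul, ENNReal.inv_two_add_inv_two, one_mul]
      have h3 : 2⁻¹ * β n ≠ ∞ := by
        refine (lt_of_le_of_lt (mul_le_mul' le_rfl (hβ n)) ?_).ne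
        simp
      change _ + 2⁻¹ * β n = _ + β n at h1
      rw [h2] at h1
      have h4 : 2⁻¹ * (2⁻¹ * β n + 2⁻¹ * β n) = 2⁻¹ * β n := by rw [← h2]
      rw [h4, ← add_assoc] at h1
      rw [(ENNReal.add_left_inj h3).1 h1, Finset.sum_range_succ]
      gcongr
  have hβ0 : Tendsto β atTop (nhds 0) := by
    have h1 : ∑' k, 2⁻¹ * β k ≠ ∞ := by
      refine (lt_of_le_of_lt (ENNReal.tsum_le_of_sum_range_le (c := 1) fun n => (hsum n).trans ?_)
        ENNReal.one_lt_top).ne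
      calc _ ≤ ∫⁻ _, 1 ∂P := lintegral_mono fun ω => hψ1 _
        _ = 1 := by simp
    have h2 := ENNReal.tendsto_atTop_zero_of_tsum_ne_top h1
    have h3 := ENNReal.Tendsto.const_mul (a := 2) h2 (.inr (by simp))
    simpa [← mul_assoc, ENNReal.mul_inv_cancel] using h3
  -- Either the process is at height `m` or above at time `k`, which Markov's inequality bounds by
  -- `1 / m`, or it moves from below `m`, where `ψ ≥ 2⁻¹ ^ m`. Afterwards `k → ∞` and then `m → ∞`.
  have hbound : ∀ m : ℕ, m ≠ 0 → ∀ k, P (⋂ n, (U n ∪ D n)) ≤ (m : ℝ≥0∞)⁻¹ + 2 ^ m * (2 * β k) := by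
    intro m hm0 k
    have h1 : ⋂ n, (U n ∪ D n) ⊆ {ω | (m : ℝ≥0∞) ≤ X k ω} ∪ ((U k ∪ D k) ∩ {ω | X k ω < m}) := by
      intro ω hω
      by_cases h : X k ω < m
      · exact .inr ⟨Set.mem_iInter.1 hω k, h⟩
      · exact .inl (by simpa using h)
    refine (measure_mono h1).trans ((measure_union_le _ _).trans (add_le_add ?_ ?_))
    · have := meas_ge_le_lintegral_div (μ := P) (f := fun ω => (X k ω : ℝ≥0∞))
        (hm k _).aemeasurable (ε := m) (by simpa using hm0) (by simp)
      rwa [hmean, one_div] at this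
    · have h2 : 2 ^ m * (2 * β k) = ∫⁻ ω, 2 ^ m * ((U k).indicator (fun ω => ψ (X k ω)) ω +
          (D k).indicator (fun ω => ψ (X k ω)) ω) ∂P := by
        have hadd : Measurable fun ω => (U k).indicator (fun ω => ψ (X k ω)) ω +
          (D k).indicator (fun ω => ψ (X k ω)) ω :=
          ((hm k ψ).indicator (hU k)).add ((hm k ψ).indicator (hD k))
        rw [lintegral_const_mul _ hadd,
          lintegral_add_right _ ((hm k ψ).indicator (hD k)), ← hfair k ψ, two_mul]
      have hms : MeasurableSet ((U k ∪ D k) ∩ {ω | X k ω < m}) :=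
        ((hU k).union (hD k)).inter (hX k (measurableSet_Iio (a := m)))
      rw [h2, ← lintegral_indicator_one hms]
      refine lintegral_mono fun ω => ?_
      by_cases hω : ω ∈ (U k ∪ D k) ∩ {ω | X k ω < m}
      · have h3 : (1 : ℝ≥0∞) ≤ 2 ^ m * ψ (X k ω) := by
          have h4 : ψ m ≤ ψ (X k ω) := pow_le_pow_of_le_one zero_le (by simp) (le_of_lt hω.2)
          refine le_trans (le_of_eq ?_) (mul_le_mul' le_rfl h4)
          simp only [ψ]
          rw [← mul_pow, ENNReal.mul_inv_cancel (by simp) (by simp), one_pow]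
        simp only [hω, Set.indicator_of_mem, Pi.one_apply]
        refine h3.trans (mul_le_mul' le_rfl ?_)
        rcases hω.1 with h | h
        · simp [h]
        · simp [h]
      · simp [hω]
  have h1 : ∀ m : ℕ, m ≠ 0 → P (⋂ n, (U n ∪ D n)) ≤ (m : ℝ≥0∞)⁻¹ := by
    intro m hm0
    have h2 : Tendsto (fun k => (m : ℝ≥0∞)⁻¹ + 2 ^ m * (2 * β k)) atTop
        (nhds ((m : ℝ≥0∞)⁻¹ + 2 ^ m * (2 * 0))) :=
      tendsto_const_nhds.add (ENNReal.Tendsto.const_mul (ENNReal.Tendsto.const_mul hβ0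
        (.inr (by simp))) (.inr (by simp)))
    simpa using ge_of_tendsto' h2 (hbound m hm0)
  refine le_antisymm (ge_of_tendsto ENNReal.tendsto_inv_nat_nhds_zero ?_) zero_le
  filter_upwards [eventually_ne_atTop 0] with m hm0 using h1 m hm0

end Walk

/-! ### Measurability of the meetings and fairness of their coins -/

namespace Interaction

variable {V : Type*} {B : Set V}

/-- The space of connection times, points and coins. -/
abbrev Env (V : Type*) : Type _ := (V → V → ℝ≥0∞) × Set V × (Sym2 V → Bool)

/-- The direction of the connections as given by coins, for a reference orientation `o`. -/
def dir (o : V → V → Bool) (c : Sym2 V → Bool) (p q : V) : Prop := c s(p, q) = o p q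

variable {o : V → V → Bool}

lemma measurable_time (p q : V) : Measurable fun x : Env V => x.1 p q := by fun_prop

lemma measurable_dir (p q : V) : Measurable fun x : Env V => dir o x.2.2 p q := by
  have : Measurable fun x : Env V => x.2.2 s(p, q) := by fun_prop
  exact measurableSet_setOfPred.1 (this (measurableSet_singleton _))

lemma measurable_mem_pts (p : V) : Measurable fun x : Env V => p ∈ x.2.1 :=
  (measurable_set_mem p).comp (measurable_fst.comp measurable_snd)

variable [Countable V]

lemma measurable_aliveApprox {S : Env V → Set V} (hS : ∀ p, Measurable fun x => p ∈ S x) (n : ℕ) :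
    ∀ p q, Measurable fun x : Env V => AliveApprox x.1 (dir o x.2.2) (S x) n p q := by
  induction n with
  | zero => exact fun p q => hS q
  | succ n ih =>
    intro p q
    refine (hS q).and (Measurable.forall fun r => (hS r).imp (Measurable.imp ?_
      ((measurable_dir q r).imp (ih q r).not)))
    exact measurableSet_setOfPred.1 (measurableSet_lt (measurable_time q r) (measurable_time p q))

lemma measurable_alive {S : Env V → Set V} (hS : ∀ p, Measurable fun x => p ∈ S x) (p q : V) :
    Measurable fun x : Env V => Alive x.1 (dir o x.2.2) (S x) p q :=
  Measurable.exists fun _ => Measurable.forall fun _ => measurable_const.imp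
    (measurable_aliveApprox hS _ p q)

lemma measurable_meet (p q : V) :
    Measurable fun x : Env V => Meet x.1 (dir o x.2.2) x.2.1 B p q := by
  have hA := fun p q => measurable_alive (o := o) measurable_mem_pts p q
  have hB := fun p q => measurable_alive (o := o) (S := fun _ => B) (fun _ => measurable_const) p q
  refine (measurable_mem_pts p).and ((measurable_mem_pts q).and (Measurable.and ?_
    (((hB q p).iff (hA q p)).not.and ((hB p q).and (hA p q)))))
  exact measurableSet_setOfPred.1 ((measurable_time p q) (measurableSet_singleton ∞)).compl

lemma measurable_offspring (z p : V) : Measurable fun x : Env V =>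
    Relation.ReflTransGen (Child x.1 (dir o x.2.2) x.2.1 B) z p := by
  -- Descent in exactly `n` generations, a countable union over the intermediate points.
  let R : ℕ → V → Env V → Prop := fun n => n.rec (fun p _ => p = z)
    (fun _ Q p x => ∃ r, Q r x ∧ Child x.1 (dir o x.2.2) x.2.1 B r p)
  have hR : ∀ n p, Measurable (R n p) := by
    intro n
    induction n with
    | zero => exact fun p => measurable_const
    | succ n ih =>
      exact fun p => Measurable.exists fun r => (ih r).and
        ((measurable_meet r p).and (measurable_dir p r))
  have : (fun x : Env V => Relation.ReflTransGen (Child x.1 (dir o x.2.2) x.2.1 B) z p) =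
      fun x => ∃ n, R n p x := by
    funext x
    refine propext ⟨fun h => ?_, fun ⟨n, hn⟩ => ?_⟩
    · induction h with
      | refl => exact ⟨0, rfl⟩
      | tail _ h ih =>
        obtain ⟨n, hn⟩ := ih
        exact ⟨n + 1, _, hn, h⟩
    · induction n generalizing p with
      | zero =>
        have hn : p = z := hn
        rw [hn]
      | succ n ih =>
        obtain ⟨r, hr, h⟩ := hn
        exact (ih r ⟨n, hr⟩ hr).tail h
  rw [this]
  exact Measurable.exists fun n => hR n p

lemma measurable_mem_meetings (z : V) (u : V × V) : Measurable fun x : Env V =>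
    u ∈ meetings x.1 (dir o x.2.2) x.2.1 B z :=
  (measurable_meet _ _).and (measurable_offspring _ _)

lemma measurable_isNth (z : V) (n : ℕ) (u : V × V) : Measurable fun x : Env V =>
    IsNth x.1 (dir o x.2.2) x.2.1 B z n u := by
  refine (measurable_mem_meetings z u).and ?_
  have h : Measurable fun x : Env V => {v : V × V | v ∈ meetings x.1 (dir o x.2.2) x.2.1 B z ∧
      x.1 v.1 v.2 < x.1 u.1 u.2} := by
    refine measurable_set_iff.2 fun v => (measurable_mem_meetings z v).and ?_
    exact measurableSet_setOfPred.1 (measurableSet_lt (measurable_time _ _) (measurable_time _ _))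
  exact measurableSet_setOfPred.1 ((measurable_encard.comp h) (measurableSet_singleton _))

lemma measurable_birth (z : V) (n : ℕ) : Measurable fun x : Env V =>
    ∃ u : V × V, IsNth x.1 (dir o x.2.2) x.2.1 B z n u ∧ dir o x.2.2 u.2 u.1 :=
  Measurable.exists fun u => (measurable_isNth z n u).and (measurable_dir _ _)

lemma measurable_death (z : V) (n : ℕ) : Measurable fun x : Env V =>
    ∃ u : V × V, IsNth x.1 (dir o x.2.2) x.2.1 B z n u ∧ ¬ dir o x.2.2 u.2 u.1 :=
  Measurable.exists fun u => (measurable_isNth z n u).and (measurable_dir _ _).not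

lemma measurable_walk (z : V) (n : ℕ) : Measurable fun x : Env V =>
    walk x.1 (dir o x.2.2) x.2.1 B z n := by
  unfold walk
  refine measurable_const.add (Finset.measurable_fun_sum _ fun k _ => Measurable.sub ?_ ?_)
  · exact Measurable.ite (measurableSet_setOfPred.2 (measurable_birth z k)) measurable_const
      measurable_const
  · exact Measurable.ite (measurableSet_setOfPred.2 (measurable_death z k)) measurable_const
      measurable_const

variable {Ω : Type*} [MeasurableSpace Ω] {P : Measure Ω} {E : Ω → Env V}
  [DecidableEq (Sym2 V)]

open Classical in
-- Whether `u` is the meeting number `n`, and the value of the walk then, do not change when the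
-- coin of `u` is overwritten by `true`; the overwritten environment is independent of that coin.
-- Summing over `u` gives a right side free of `g`, so births and deaths receive equal weight.
lemma fair_step (hE : Measurable E) (hG : ∀ᵐ ω ∂P, Good (E ω).1 (E ω).2.1)
    (hB : ∀ ω, B ⊆ (E ω).2.1)
    (hind : ∀ s, IndepFun (fun ω => (E ω).2.2 s)
      (fun ω => ((E ω).1, (E ω).2.1, Function.update (E ω).2.2 s true)) P)
    (hcoin : ∀ s b, P {ω | (E ω).2.2 s = b} = 2⁻¹)
    (z : V) (n : ℕ) (φ : ℤ → ℝ≥0∞) (g : V × V → Bool) :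
    ∫⁻ ω, (if ∃ u : V × V, IsNth (E ω).1 (dir o (E ω).2.2) (E ω).2.1 B z n u ∧
        (E ω).2.2 s(u.1, u.2) = g u
      then φ (walk (E ω).1 (dir o (E ω).2.2) (E ω).2.1 B z n) else 0) ∂P =
    ∑' u : V × V, (∫⁻ ω, (if IsNth (E ω).1 (dir o (E ω).2.2) (E ω).2.1 B z n u
      then φ (walk (E ω).1 (dir o (E ω).2.2) (E ω).2.1 B z n) else 0) ∂P) * 2⁻¹ := by
  let Φ : V × V → Env V → ℝ≥0∞ := fun u x =>
    if IsNth x.1 (dir o x.2.2) x.2.1 B z n u then φ (walk x.1 (dir o x.2.2) x.2.1 B z n) else 0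
  have hΦ : ∀ u, Measurable (Φ u) := fun u =>
    Measurable.ite (measurableSet_setOfPred.2 (measurable_isNth z n u))
      ((measurable_of_countable φ).comp (measurable_walk z n)) measurable_const
  have hc : ∀ u : V × V, Measurable fun ω => (E ω).2.2 s(u.1, u.2) := fun u => by fun_prop
  have hS : ∀ u : V × V, MeasurableSet {ω | (E ω).2.2 s(u.1, u.2) = g u} := fun u =>
    hc u (measurableSet_singleton _)
  have h1 : ∀ᵐ ω ∂P, (if ∃ u : V × V, IsNth (E ω).1 (dir o (E ω).2.2) (E ω).2.1 B z n u ∧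
        (E ω).2.2 s(u.1, u.2) = g u
      then φ (walk (E ω).1 (dir o (E ω).2.2) (E ω).2.1 B z n) else 0) =
      ∑' u, ({b | b = g u}.indicator 1 ((E ω).2.2 s(u.1, u.2))) * Φ u (E ω) := by
    filter_upwards [hG] with ω hG
    by_cases h : ∃ u : V × V, IsNth (E ω).1 (dir o (E ω).2.2) (E ω).2.1 B z n u ∧
        (E ω).2.2 s(u.1, u.2) = g u
    · rw [if_pos h]
      obtain ⟨u, hu, hu'⟩ := h
      rw [tsum_eq_single u]
      · simp [Φ, hu, hu']
      · intro v hv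
        have : ¬ IsNth (E ω).1 (dir o (E ω).2.2) (E ω).2.1 B z n v :=
          fun h => hv (hG.isNth_unique h hu)
        simp [Φ, this]
    · rw [if_neg h]
      refine (ENNReal.tsum_eq_zero.2 fun u => ?_).symm
      by_cases hu : IsNth (E ω).1 (dir o (E ω).2.2) (E ω).2.1 B z n u
      · have : (E ω).2.2 s(u.1, u.2) ≠ g u := fun h' => h ⟨u, hu, h'⟩
        simp [this]
      · simp [Φ, hu]
  rw [lintegral_congr_ae h1, lintegral_tsum fun u => ?_]
  · refine tsum_congr fun u => ?_
    have h2 : ∀ᵐ ω ∂P, Φ u (E ω) =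
        Φ u ((E ω).1, (E ω).2.1, Function.update (E ω).2.2 s(u.1, u.2) true) := by
      filter_upwards [hG] with ω hG
      -- The altered coin sits at the time of `u` itself, not strictly before it.
      have hI : ∀ p ∈ (E ω).2.1, ∀ q ∈ (E ω).2.1, (E ω).1 p q < (E ω).1 u.1 u.2 →
          (dir o (E ω).2.2 p q ↔ dir o (Function.update (E ω).2.2 s(u.1, u.2) true) p q) := by
        intro p _ q _ hlt
        unfold dir
        rw [Function.update_of_ne]
        intro h
        rcases Sym2.eq_iff.1 h with ⟨rfl, rfl⟩ | ⟨rfl, rfl⟩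
        · exact lt_irrefl _ hlt
        · rw [hG.symm] at hlt
          exact lt_irrefl _ hlt
      simp only [Φ]
      by_cases hu : IsNth (E ω).1 (dir o (E ω).2.2) (E ω).2.1 B z n u
      · rw [if_pos hu, if_pos ((hG.isNth_congr (hB ω) hI le_rfl).1 hu),
          hG.walk_congr (hB ω) hu hI]
      · rw [if_neg hu, if_neg (fun h => hu ((hG.isNth_congr (hB ω) hI le_rfl).2 h))]
    have hmeas2 : Measurable fun ω =>
        ((E ω).1, (E ω).2.1, Function.update (E ω).2.2 s(u.1, u.2) true) := by
      refine (by fun_prop : Measurable fun ω => (E ω).1).prodMk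
        ((by fun_prop : Measurable fun ω => (E ω).2.1).prodMk (measurable_pi_lambda _ fun s => ?_))
      by_cases hs : s = s(u.1, u.2)
      · subst hs
        simp
      · simp only [Function.update_of_ne hs]
        fun_prop
    have hind' := (hind s(u.1, u.2)).comp
      (φ := fun b => ({b | b = g u}.indicator 1 b : ℝ≥0∞)) (ψ := Φ u)
      (measurable_of_countable _) (hΦ u)
    have h3 := lintegral_mul_eq_lintegral_mul_lintegral_of_indepFun''
        ((measurable_of_countable _).comp (hc u)).aemeasurable
        ((hΦ u).comp hmeas2).aemeasurable hind'
    rw [lintegral_congr_ae (h2.mono fun ω h => by rw [h])]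
    refine h3.trans ?_
    rw [mul_comm]
    congr 1
    · exact (lintegral_congr_ae h2).symm
    · rw [← hcoin s(u.1, u.2) (g u), ← lintegral_indicator_one (hS u)]
      rfl
  · have h3 : Measurable fun b => ({b | b = g u}.indicator 1 b : ℝ≥0∞) := measurable_of_countable _
    exact ((h3.comp (hc u)).mul ((hΦ u).comp hE)).aemeasurable

open Classical in
/-- The offspring of any point only has finitely many meetings. -/
theorem ae_finite_meetings [IsProbabilityMeasure P] (hE : Measurable E) (hG : ∀ᵐ ω ∂P, Good (E ω).1 (E ω).2.1)
    (hB : ∀ ω, B ⊆ (E ω).2.1)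
    (hind : ∀ s, IndepFun (fun ω => (E ω).2.2 s)
      (fun ω => ((E ω).1, (E ω).2.1, Function.update (E ω).2.2 s true)) P)
    (hcoin : ∀ s b, P {ω | (E ω).2.2 s = b} = 2⁻¹)
    (ho : ∀ p q, p ≠ q → o q p = !o p q) (z : V) :
    ∀ᵐ ω ∂P, (meetings (E ω).1 (dir o (E ω).2.2) (E ω).2.1 B z).Finite := by
  set U : ℕ → Set Ω := fun n => {ω | ∃ u : V × V,
    IsNth (E ω).1 (dir o (E ω).2.2) (E ω).2.1 B z n u ∧ dir o (E ω).2.2 u.2 u.1}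
  set D : ℕ → Set Ω := fun n => {ω | ∃ u : V × V,
    IsNth (E ω).1 (dir o (E ω).2.2) (E ω).2.1 B z n u ∧ ¬ dir o (E ω).2.2 u.2 u.1}
  set W : ℕ → Ω → ℤ := fun n ω => walk (E ω).1 (dir o (E ω).2.2) (E ω).2.1 B z n
  have hdir : ∀ (c : Sym2 V → Bool) p q, p ≠ q → (dir o c p q ↔ ¬ dir o c q p) := by
    intro c p q hpq
    unfold dir
    rw [Sym2.eq_swap, ho p q hpq]
    cases c s(q, p) <;> cases o p q <;> simp
  have hW : ∀ᵐ ω ∂P, ∀ n, 0 ≤ W n ω := by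
    filter_upwards [hG] with ω hG n using hG.walk_nonneg (hB ω) (hdir _) n
  have hWs : ∀ n ω, W (n + 1) ω = W n ω + ((if ω ∈ U n then 1 else 0) -
      (if ω ∈ D n then 1 else 0)) := by
    intro n ω
    simp only [W, walk, Finset.sum_range_succ, ← add_assoc]
    rfl
  have hdisj : ∀ᵐ ω ∂P, ∀ n, ω ∈ U n → ω ∉ D n := by
    filter_upwards [hG] with ω hG n
    rintro ⟨u, hu, hu'⟩ ⟨v, hv, hv'⟩
    rw [hG.isNth_unique hu hv] at hu'
    exact hv' hu'
  have hfair : ∀ n (φ : ℤ → ℝ≥0∞), ∫⁻ ω, (U n).indicator (fun ω => φ (W n ω)) ω ∂P =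
      ∫⁻ ω, (D n).indicator (fun ω => φ (W n ω)) ω ∂P := by
    intro n φ
    -- A birth at `u` means that the coin equals `o u.2 u.1`, a death that it is the opposite.
    have h1 := fair_step (o := o) hE hG hB hind hcoin z n φ fun u => o u.2 u.1
    have h2 := fair_step (o := o) hE hG hB hind hcoin z n φ fun u => !o u.2 u.1
    refine Eq.trans ?_ ((h1.trans h2.symm).trans ?_)
    · refine lintegral_congr fun ω => ?_
      rw [Set.indicator_apply]
      refine if_congr ?_ rfl rfl
      refine exists_congr fun u => and_congr_right fun _ => ?_
      rw [dir, Sym2.eq_swap]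
    · refine lintegral_congr fun ω => ?_
      rw [Set.indicator_apply]
      refine if_congr ?_ rfl rfl
      refine exists_congr fun u => and_congr_right fun _ => ?_
      rw [dir, Sym2.eq_swap, Bool.eq_not]
  have hmW : ∀ n, Measurable (W n) := fun n => (measurable_walk z n).comp hE
  have hzero := measure_forall_moves_eq_zero (P := P) (X := fun n ω => (W n ω).toNat) (U := U)
    (D := D) (fun n => (measurable_of_countable Int.toNat).comp (hmW n))
    (fun n => hE (measurableSet_setOfPred.2 (measurable_birth z n)))
    (fun n => hE (measurableSet_setOfPred.2 (measurable_death z n)))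
    (ae_of_all _ fun ω => by simp [W, walk]) ?_ ?_ ?_
    (fun n φ => hfair n fun x => φ x.toNat)
  · have h3 : ∀ᵐ ω ∂P, ω ∉ ⋂ n, (U n ∪ D n) := measure_eq_zero_iff_ae_notMem.1 hzero
    filter_upwards [h3, hG] with ω h3 hG
    -- With infinitely many meetings every rank would be taken, by a birth or a death, and the walk
    -- would move forever.
    by_contra hinf
    refine h3 (Set.mem_iInter.2 fun n => ?_)
    obtain ⟨u, hu⟩ := hG.exists_isNth (hB ω) hinf n
    by_cases hd : dir o (E ω).2.2 u.2 u.1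
    · exact .inl ⟨u, hu, hd⟩
    · exact .inr ⟨u, hu, hd⟩
  · intro n
    filter_upwards [hW, hdisj] with ω h1 h2 hu
    have h3 := hWs n ω
    rw [if_pos hu, if_neg (h2 n hu)] at h3
    exact ⟨by have := h1 n; omega, h2 n hu⟩
  · intro n
    filter_upwards [hW, hdisj] with ω h1 h2 hd
    have h3 := hWs n ω
    rw [if_pos hd, if_neg fun hu => h2 n hu hd] at h3
    have := h1 n
    have := h1 (n + 1)
    omega
  · intro n
    filter_upwards with ω hu hd
    have h3 := hWs n ω
    rw [if_neg hu, if_neg hd] at h3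
    simp only [h3, sub_self, add_zero]

end Interaction

/-! ### Factorial moments of a Poisson point process -/

lemma ENNReal.prod_tsum_nat {n : ℕ} (g : Fin n → ℕ → ℝ≥0∞) :
    ∏ i, ∑' j, g i j = ∑' k : Fin n → ℕ, ∏ i, g i (k i) := by
  induction n with
  | zero => simp
  | succ n ih =>
    rw [Fin.prod_univ_succ, ih fun i => g i.succ,
      ← (Fin.consEquiv fun _ : Fin (n + 1) => ℕ).tsum_eq, ENNReal.tsum_prod',
      ← ENNReal.tsum_mul_right]
    refine tsum_congr fun a => ?_
    rw [← ENNReal.tsum_mul_left]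
    refine tsum_congr fun k => ?_
    simp [Fin.prod_univ_succ, Fin.consEquiv]

lemma lintegral_poissonMeasure_natCast (r : ℝ≥0) : ∫⁻ n, (n : ℝ≥0∞) ∂(poissonMeasure r) = r := by
  rw [lintegral_countable', tsum_eq_zero_add' ENNReal.summable]
  have h : ∀ n : ℕ, ((n + 1 : ℕ) : ℝ≥0∞) * poissonMeasure r {n + 1} = r * poissonMeasure r {n} := by
    intro n
    rw [poissonMeasure_singleton, poissonMeasure_singleton, ← ENNReal.ofReal_natCast,
      ← ENNReal.ofReal_coe_nnreal, ← ENNReal.ofReal_mul (by positivity),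
      ← ENNReal.ofReal_mul (by positivity), Nat.factorial_succ]
    congr 1
    push_cast
    have : (n.factorial : ℝ) ≠ 0 := by positivity
    field_simp
    ring
  simp_rw [h]
  rw [ENNReal.tsum_mul_left]
  have h1 : ∑' n, poissonMeasure r {n} = 1 := by
    have := lintegral_countable' (μ := poissonMeasure r) (fun _ : ℕ => (1 : ℝ≥0∞))
    simpa using this.symm
  simp [h1]

/-- Since exp(-r) ≥ 1 - r, the probability 1 - exp(-r)(1 + r) is at most 1 - (1 - r)(1 + r). -/
lemma poissonMeasure_two_le (r : ℝ≥0) : poissonMeasure r {n | 2 ≤ n} ≤ r ^ 2 := by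
  have h1 : {n : ℕ | 2 ≤ n} = {0, 1}ᶜ := by
    ext n
    simp only [Set.mem_ofPred_eq, Set.mem_compl_iff, Set.mem_insert_iff, Set.mem_singleton_iff]
    omega
  have h2 : (poissonMeasure r).real {0, 1} = Real.exp (-r) + Real.exp (-r) * r := by
    rw [show ({0, 1} : Set ℕ) = {0} ∪ {1} from rfl,
      measureReal_union (by simp) (measurableSet_singleton _), poissonMeasure_real_singleton,
      poissonMeasure_real_singleton]
    simp
  have h3 : (poissonMeasure r).real {n | 2 ≤ n} ≤ (r : ℝ) ^ 2 := by
    rw [h1, probReal_compl_eq_one_sub (by measurability), h2]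
    have h4 := Real.add_one_le_exp (-(r : ℝ))
    have h5 : (0 : ℝ) ≤ r := r.2
    nlinarith
  rw [← ENNReal.ofReal_toReal (measure_ne_top (poissonMeasure r) _)]
  refine (ENNReal.ofReal_le_ofReal h3).trans_eq ?_
  rw [ENNReal.ofReal_pow (NNReal.coe_nonneg r), ENNReal.ofReal_coe_nnreal]

namespace IsPoissonPointProcess

variable {Ω X : Type*} [MeasurableSpace Ω] [MeasurableSpace X] {P : Measure Ω}
  {y : ℕ → Ω → X} {μ : Measure X}

lemma toENNReal_pointCount {Ω X : Type*} {y : ℕ → Ω → X} (B : Set X) (ω : Ω) :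
    ((pointCount y B ω : ℕ∞) : ℝ≥0∞) = ∑' k, B.indicator 1 (y k ω) := by
  rw [pointCount, ← ENNReal.tsum_set_one, tsum_subtype _ fun _ => (1 : ℝ≥0∞)]
  rfl

lemma measurable_pointCount (h : IsPoissonPointProcess P y μ) {B : Set X} (hB : MeasurableSet B) :
    Measurable (pointCount y B) :=
  measurable_encard.comp (measurable_set_iff.2 fun k => measurableSet_setOfPred.1 (h.measurable k hB))

lemma lintegral_pointCount_eq_sum (h : IsPoissonPointProcess P y μ) {B : Set X}
    (hB : MeasurableSet B) : ∫⁻ ω, ((pointCount y B ω : ℕ∞) : ℝ≥0∞) ∂P =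
      Measure.sum (fun k => P.map (y k)) B := by
  have hm : ∀ k, Measurable fun ω => (B.indicator 1 (y k ω) : ℝ≥0∞) := fun k =>
    (measurable_one.indicator hB).comp (h.measurable k)
  rw [Measure.sum_apply _ hB]
  simp_rw [toENNReal_pointCount]
  rw [lintegral_tsum fun k => (hm k).aemeasurable]
  refine tsum_congr fun k => ?_
  rw [Measure.map_apply (h.measurable k) hB, ← lintegral_indicator_one (h.measurable k hB)]
  rfl

/-- On sets of finite intensity this is the mean of a Poisson count; spanning sets extend it. -/
lemma sum_map (h : IsPoissonPointProcess P y μ) [SigmaFinite μ] :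
    Measure.sum (fun k => P.map (y k)) = μ := by
  have hf : ∀ B, MeasurableSet B → μ B < ∞ → Measure.sum (fun k => P.map (y k)) B = μ B := by
    intro B hB hfin
    have h1 := h.hasLaw_count B hB hfin
    rw [← h.lintegral_pointCount_eq_sum hB, ← lintegral_map (f := fun n : ℕ∞ => (n : ℝ≥0∞)) (measurable_of_countable _)
      (h.measurable_pointCount hB), h1.map_eq,
      lintegral_map (measurable_of_countable _) (measurable_of_countable _)]
    simp only [ENat.toENNReal_coe]
    rw [lintegral_poissonMeasure_natCast, ENNReal.coe_toNNReal hfin.ne]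
  refine Measure.ext_of_iUnion_eq_univ (iUnion_spanningSets μ) fun n => ?_
  refine Measure.ext fun s hsm => ?_
  rw [Measure.restrict_apply hsm, Measure.restrict_apply hsm]
  exact hf _ (hsm.inter (measurableSet_spanningSets μ n))
    ((measure_mono Set.inter_subset_right).trans_lt (measure_spanningSets_lt_top μ n))

lemma lintegral_pointCount (h : IsPoissonPointProcess P y μ) [SigmaFinite μ] {B : Set X}
    (hB : MeasurableSet B) : ∫⁻ ω, ((pointCount y B ω : ℕ∞) : ℝ≥0∞) ∂P = μ B := by
  rw [h.lintegral_pointCount_eq_sum hB, h.sum_map]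

/-- Campbell's formula. -/
lemma tsum_lintegral (h : IsPoissonPointProcess P y μ) [SigmaFinite μ] {g : X → ℝ≥0∞}
    (hg : Measurable g) : ∑' k, ∫⁻ ω, g (y k ω) ∂P = ∫⁻ x, g x ∂μ := by
  conv_rhs => rw [← h.sum_map]
  rw [lintegral_sum_measure]
  exact tsum_congr fun k => (lintegral_map hg (h.measurable k)).symm

/-- The product of the counts expands into the number of tuples in the box, and disjointness of the
sides makes the counts independent. -/
lemma sum_map_tuple_apply (h : IsPoissonPointProcess P y μ) [SigmaFinite μ] {n : ℕ}
    {s : Fin n → Set X} (hs : ∀ i, MeasurableSet (s i))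
    (hd : Pairwise fun i j => Disjoint (s i) (s j)) :
    Measure.sum (fun k : Fin n → ℕ => P.map fun ω i => y (k i) ω) (Set.univ.pi s) =
      ∏ i, μ (s i) := by
  have hm : ∀ k : Fin n → ℕ, Measurable fun ω i => y (k i) ω :=
    fun k => measurable_pi_lambda _ fun i => h.measurable _
  have hpi : MeasurableSet (Set.univ.pi s) := MeasurableSet.univ_pi hs
  rw [Measure.sum_apply _ hpi]
  have h1 : ∀ i, Measurable fun ω => ((pointCount y (s i) ω : ℕ∞) : ℝ≥0∞) := fun i =>
    (measurable_of_countable _).comp (h.measurable_pointCount (hs i))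
  have h2 : iIndepFun (fun i ω => ((pointCount y (s i) ω : ℕ∞) : ℝ≥0∞)) P :=
    (h.iIndepFun_count n s hs hd).comp (fun _ n => (n : ℝ≥0∞)) fun _ => measurable_of_countable _
  have h3 := lintegral_prod_eq_prod_lintegral_of_indepFun Finset.univ _ h2 h1
  simp_rw [h.lintegral_pointCount (hs _)] at h3
  rw [← h3]
  simp_rw [toENNReal_pointCount, ENNReal.prod_tsum_nat]
  have hprod : ∀ k : Fin n → ℕ,
      Measurable fun ω => ∏ i, ((s i).indicator 1 (y (k i) ω) : ℝ≥0∞) := fun k =>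
    Finset.measurable_fun_prod _ fun i _ => (measurable_one.indicator (hs i)).comp (h.measurable _)
  rw [lintegral_tsum fun k => (hprod k).aemeasurable]
  refine tsum_congr fun k => ?_
  rw [Measure.map_apply (hm k) hpi, ← lintegral_indicator_one (hm k hpi)]
  refine lintegral_congr fun ω => ?_
  by_cases hω : ∀ i, y (k i) ω ∈ s i
  · simp [Set.indicator, hω]
  · obtain ⟨i, hi⟩ := not_forall.1 hω
    rw [Finset.prod_eq_zero (Finset.mem_univ i) (by simp [hi])]
    simp [Set.indicator, hω]

lemma exists_floor_injective {n : ℕ} {t : Fin n → ℝ} (ht : Function.Injective t) :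
    ∃ m : ℕ, Function.Injective fun i => ⌊m * t i⌋ := by
  have h1 : ∀ i j, i ≠ j → ∃ m₀ : ℕ, ∀ m ≥ m₀, ⌊(m : ℝ) * t i⌋ ≠ ⌊(m : ℝ) * t j⌋ := by
    intro i j hij
    have hpos : 0 < |t i - t j| := abs_pos.2 (sub_ne_zero.2 (ht.ne hij))
    obtain ⟨m₀, hm₀⟩ := exists_nat_gt (|t i - t j|⁻¹)
    refine ⟨m₀, fun m hm heq => ?_⟩
    have h2 := Int.abs_sub_lt_one_of_floor_eq_floor heq
    rw [← mul_sub, abs_mul, Nat.abs_cast] at h2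
    have h3 : |t i - t j|⁻¹ < m := hm₀.trans_le (by exact_mod_cast hm)
    rw [inv_lt_iff_one_lt_mul₀ hpos] at h3
    linarith
  choose! m₀ hm₀ using h1
  refine ⟨Finset.univ.sup fun p : Fin n × Fin n => m₀ p.1 p.2, fun i j h => ?_⟩
  by_contra hij
  exact hm₀ i j hij _ (Finset.le_sup (f := fun p : Fin n × Fin n => m₀ p.1 p.2)
    (Finset.mem_univ (i, j))) h

/-- Factorial moments of a Poisson point process whose points are separated by `τ`. -/
lemma tsum_lintegral_le (h : IsPoissonPointProcess P y μ) [SigmaFinite μ] {τ : X → ℝ}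
    (hτ : Measurable τ) (hinj : ∀ᵐ ω ∂P, Function.Injective fun k => τ (y k ω)) {n : ℕ}
    {g : (Fin n → X) → ℝ≥0∞} (hg : Measurable g) :
    ∑' k : {k : Fin n → ℕ // Function.Injective k}, ∫⁻ ω, g (fun i => y (k.1 i) ω) ∂P ≤
      ∫⁻ x, g x ∂(Measure.pi fun _ => μ) := by
  set M : Measure (Fin n → X) := Measure.sum fun k : Fin n → ℕ => P.map fun ω i => y (k i) ω
  -- Boxes whose coordinates have `τ` in different cells of a grid of mesh `1 / m`, hence with
  -- disjoint sides. They cover all tuples with distinct `τ`-values; overlaps are harmless when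
  -- comparing restrictions of two measures.
  set C : ℕ × {a : Fin n → ℤ // Function.Injective a} → Fin n → Set X :=
    fun c i => {x | ⌊c.1 * τ x⌋ = c.2.1 i}
  have hC : ∀ c i, MeasurableSet (C c i) := fun c i =>
    (Int.measurable_floor.comp (hτ.const_mul _)) (measurableSet_singleton _)
  set D : Set (Fin n → X) := ⋃ c, Set.univ.pi (C c)
  have hD : ∀ x : Fin n → X, Function.Injective (fun i => τ (x i)) → x ∈ D := by
    intro x hx
    obtain ⟨m, hm⟩ := exists_floor_injective hx
    exact Set.mem_iUnion.2 ⟨⟨m, _, hm⟩, fun i _ => rfl⟩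
  have hDm : MeasurableSet D := MeasurableSet.iUnion fun c => MeasurableSet.univ_pi (hC c)
  have hm : ∀ k : Fin n → ℕ, Measurable fun ω i => y (k i) ω :=
    fun k => measurable_pi_lambda _ fun i => h.measurable _
  have hM : M.restrict D = (Measure.pi fun _ => μ).restrict D := by
    refine Measure.restrict_iUnion_congr.2 fun c => ?_
    rw [Measure.restrict_pi_pi]
    refine (Measure.pi_eq fun s hs => ?_).symm
    rw [Measure.restrict_apply (MeasurableSet.univ_pi hs), ← Set.pi_inter_distrib,
      h.sum_map_tuple_apply fun i => (hs i).inter (hC c i)]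
    · exact Finset.prod_congr rfl fun i _ => (Measure.restrict_apply (hs i)).symm
    · intro i j hij
      refine Set.disjoint_left.2 fun x hx hx' => hij (c.2.2 ?_)
      exact hx.2.symm.trans hx'.2
  calc ∑' k : {k : Fin n → ℕ // Function.Injective k}, ∫⁻ ω, g (fun i => y (k.1 i) ω) ∂P
      ≤ ∑' k : {k : Fin n → ℕ // Function.Injective k},
          ∫⁻ ω, D.indicator g (fun i => y (k.1 i) ω) ∂P := by
        refine ENNReal.tsum_le_tsum fun k => lintegral_mono_ae ?_
        filter_upwards [hinj] with ω hω
        rw [Set.indicator_of_mem (hD _ (hω.comp k.2))]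
    _ ≤ ∑' k : Fin n → ℕ, ∫⁻ ω, D.indicator g (fun i => y (k i) ω) ∂P :=
        ENNReal.tsum_comp_le_tsum_of_injective Subtype.val_injective _
    _ = ∫⁻ x, D.indicator g x ∂M := by
        rw [lintegral_sum_measure]
        exact tsum_congr fun k => (lintegral_map (hg.indicator hDm) (hm k)).symm
    _ = ∫⁻ x in D, g x ∂(Measure.pi fun _ => μ) := by
        rw [lintegral_indicator hDm, hM]
    _ ≤ _ := setLIntegral_le_lintegral _ _

lemma ae_mem (h : IsPoissonPointProcess P y μ) [SigmaFinite μ] {B : Set X} (hB : MeasurableSet B)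
    (hμ : μ Bᶜ = 0) : ∀ᵐ ω ∂P, ∀ k, y k ω ∈ B := by
  refine ae_all_iff.2 fun k => ?_
  rw [← h.sum_map, Measure.sum_apply _ hB.compl, ENNReal.tsum_eq_zero] at hμ
  have := hμ k
  rwa [Measure.map_apply (h.measurable k) hB.compl] at this

lemma measure_pair_le (h : IsPoissonPointProcess P y μ) {B : Set X} (hB : MeasurableSet B)
    (hfin : μ B < ∞) : P {ω | ∃ j k, j ≠ k ∧ y j ω ∈ B ∧ y k ω ∈ B} ≤ μ B ^ 2 := by
  have h1 : {ω | ∃ j k, j ≠ k ∧ y j ω ∈ B ∧ y k ω ∈ B} = pointCount y B ⁻¹' {n | 1 < n} := by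
    ext ω
    simp only [Set.mem_ofPred_eq, Set.mem_preimage, pointCount, Set.one_lt_encard_iff]
    exact ⟨fun ⟨j, k, h1, h2, h3⟩ => ⟨j, k, h2, h3, h1⟩, fun ⟨j, k, h1, h2, h3⟩ => ⟨j, k, h3, h1, h2⟩⟩
  rw [h1, ← Measure.map_apply (h.measurable_pointCount hB) (Set.to_countable _).measurableSet,
    (h.hasLaw_count B hB hfin).map_eq,
    Measure.map_apply (measurable_of_countable _) (Set.to_countable _).measurableSet]
  refine le_trans (measure_mono fun n hn => ?_) ((poissonMeasure_two_le _).trans_eq ?_)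
  · have hn : (1 : ℕ∞) < (n : ℕ∞) := hn
    exact Nat.succ_le_of_lt (by exact_mod_cast hn)
  · rw [ENNReal.coe_toNNReal hfin.ne]

end IsPoissonPointProcess

/-! ### Integrals along paths, and independent marks -/

/-- Integrating out the starting point absorbs the first edge into a new weight, whose integral is
at most `c` times the old one. -/
lemma lintegral_path_le {X : Type*} [MeasurableSpace X] {μ : Measure X} [SigmaFinite μ]
    {g : X → X → ℝ≥0∞} (hg : Measurable (Function.uncurry g)) {c : ℝ≥0∞}
    (hc : ∀ x, ∫⁻ x', g x x' ∂μ ≤ c) (n : ℕ) {h : X → ℝ≥0∞} (hh : Measurable h) :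
    ∫⁻ x : Fin (n + 1) → X, h (x 0) * ∏ i : Fin n, g (x i.castSucc) (x i.succ)
      ∂(Measure.pi fun _ => μ) ≤ c ^ n * ∫⁻ x, h x ∂μ := by
  have hpeel : ∀ (m : ℕ) (F : X → (Fin m → X) → ℝ≥0∞), Measurable (Function.uncurry F) →
      ∫⁻ x : Fin (m + 1) → X, F (x 0) (fun j => x j.succ) ∂(Measure.pi fun _ => μ) =
        ∫⁻ x', ∫⁻ x, F x x' ∂μ ∂(Measure.pi fun _ => μ) := by
    intro m F hF
    have h1 := measurePreserving_piFinSuccAbove (fun _ : Fin (m + 1) => μ) 0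
    exact (h1.lintegral_comp hF).trans (lintegral_prod_symm' _ hF)
  induction n generalizing h with
  | zero =>
    have := hpeel 0 (fun x _ => h x) (hh.comp measurable_fst)
    simp only [Finset.univ_eq_empty, Finset.prod_empty, mul_one, pow_zero, one_mul]
    rw [this]
    simp
  | succ n ih =>
    have hm : Measurable fun x : (Fin (n + 1) → X) => ∏ i : Fin n, g (x i.castSucc) (x i.succ) :=
      Finset.measurable_fun_prod _ fun i _ =>
        have hp : Measurable fun x : Fin (n + 1) → X => (x i.castSucc, x i.succ) := by fun_prop
        hg.comp hp
    have hm0 : Measurable fun p : X × X => h p.1 * g p.1 p.2 := (hh.comp measurable_fst).mul hg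
    have hm1 : Measurable (Function.uncurry fun (x : X) (x' : Fin (n + 1) → X) =>
        (h x * g x (x' 0)) * ∏ i : Fin n, g (x' i.castSucc) (x' i.succ)) :=
      (hm0.comp (measurable_fst.prodMk ((measurable_pi_apply 0).comp measurable_snd))).mul
        (hm.comp measurable_snd)
    have h1 := hpeel (n + 1) _ hm1
    have h2 : ∀ x' : Fin (n + 1) → X, ∫⁻ x, (h x * g x (x' 0)) *
        ∏ i : Fin n, g (x' i.castSucc) (x' i.succ) ∂μ =
        (∫⁻ x, h x * g x (x' 0) ∂μ) * ∏ i : Fin n, g (x' i.castSucc) (x' i.succ) := by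
      intro x'
      rw [lintegral_mul_const]
      exact hm0.comp (measurable_id.prodMk measurable_const)
    simp_rw [h2] at h1
    have h3 := ih (h := fun x' => ∫⁻ x, h x * g x x' ∂μ) hm0.lintegral_prod_left'
    have h4 : ∫⁻ x', ∫⁻ x, h x * g x x' ∂μ ∂μ ≤ c * ∫⁻ x, h x ∂μ := by
      rw [lintegral_lintegral_swap
        (f := fun x' x => h x * g x x') (hm0.comp measurable_swap).aemeasurable,
        ← lintegral_const_mul _ hh]
      refine lintegral_mono fun x => ?_
      have hgx : Measurable (g x) := hg.comp (measurable_const.prodMk measurable_id)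
      rw [lintegral_const_mul _ hgx, mul_comm]
      exact mul_le_mul' (hc x) le_rfl
    calc _ = _ := by
          refine Eq.trans (lintegral_congr fun x => ?_) h1
          rw [Fin.prod_univ_succ, ← mul_assoc]
          rfl
      _ ≤ _ := h3
      _ ≤ _ := by
        rw [pow_succ, mul_assoc]
        exact mul_le_mul' le_rfl h4

section Marks

variable {Ω : Type*} [MeasurableSpace Ω] {P : Measure Ω} [IsProbabilityMeasure P]

/-- If the marks `C` are independent with law `ν` and independent of `Y`, then the probability that
finitely many of them lie in sets depending on `Y` is bounded by the expected product of bounds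
on the conditional probabilities. -/
lemma measure_marks_le {ι 𝓨 M : Type*} [MeasurableSpace 𝓨] [MeasurableSpace M] {ν : Measure M}
    [IsProbabilityMeasure ν] {Y : Ω → 𝓨} {C : ι → Ω → M} (hY : Measurable Y)
    (hC : ∀ s, Measurable (C s)) (hlaw : ∀ s, P.map (C s) = ν) (hi : iIndepFun C P)
    (hYC : IndepFun Y (fun ω s => C s ω) P) {n : ℕ} {s : Fin n → ι} (hs : Function.Injective s)
    {J : Fin n → Set (𝓨 × M)} (hJ : ∀ i, MeasurableSet (J i)) {g : Fin n → 𝓨 → ℝ≥0∞}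
    (hg : ∀ i, Measurable (g i)) (hJg : ∀ i x, ν {c | (x, c) ∈ J i} ≤ g i x) {A : Set 𝓨}
    (hA : MeasurableSet A) :
    P {ω | Y ω ∈ A ∧ ∀ i, (Y ω, C (s i) ω) ∈ J i} ≤
      ∫⁻ ω, A.indicator 1 (Y ω) * ∏ i, g i (Y ω) ∂P := by
  have hC' : Measurable fun ω i => C (s i) ω := measurable_pi_lambda _ fun i => hC _
  have hmap : P.map (fun ω i => C (s i) ω) = Measure.pi fun _ => ν := by
    have := (iIndepFun_iff_map_fun_eq_pi_map fun i => (hC (s i)).aemeasurable).1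
      (hi.precomp hs)
    rw [this]
    simp_rw [hlaw]
  have hYC' : IndepFun Y (fun ω i => C (s i) ω) P :=
    hYC.comp (φ := id) (ψ := fun (c : ι → M) i => c (s i)) measurable_id
      (measurable_pi_lambda _ fun i => measurable_pi_apply (s i))
  have hprod := (indepFun_iff_map_prod_eq_prod_map_map hY.aemeasurable hC'.aemeasurable).1 hYC'
  rw [hmap] at hprod
  set S : Set (𝓨 × (Fin n → M)) := {p | p.1 ∈ A ∧ ∀ i, (p.1, p.2 i) ∈ J i}
  have hS : MeasurableSet S := by
    refine (measurable_fst hA).inter ?_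
    have : {p : 𝓨 × (Fin n → M) | ∀ i, (p.1, p.2 i) ∈ J i} =
        ⋂ i, (fun p : 𝓨 × (Fin n → M) => (p.1, p.2 i)) ⁻¹' J i := by
      ext p; simp
    change MeasurableSet {p : 𝓨 × (Fin n → M) | ∀ i, (p.1, p.2 i) ∈ J i}
    rw [this]
    exact MeasurableSet.iInter fun i =>
      (measurable_fst.prodMk ((measurable_pi_apply i).comp measurable_snd)) (hJ i)
  have h1 : P {ω | Y ω ∈ A ∧ ∀ i, (Y ω, C (s i) ω) ∈ J i} =
      P.map (fun ω => (Y ω, fun i => C (s i) ω)) S := by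
    rw [Measure.map_apply (hY.prodMk hC') hS]
    rfl
  have hG : Measurable fun x => (A.indicator 1 x * ∏ i, g i x : ℝ≥0∞) :=
    (measurable_one.indicator hA).mul (Finset.measurable_fun_prod _ fun i _ => hg i)
  rw [h1, hprod, Measure.prod_apply hS,
    ← lintegral_map (f := fun x => (A.indicator 1 x * ∏ i, g i x : ℝ≥0∞)) hG hY]
  refine lintegral_mono fun x => ?_
  by_cases hx : x ∈ A
  · have h2 : Prod.mk x ⁻¹' S = Set.univ.pi fun i => {c | (x, c) ∈ J i} := by
      ext c
      simp [S, hx]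
    rw [h2, Measure.pi_pi]
    simp only [hx, Set.indicator_of_mem, Pi.one_apply, one_mul]
    exact Finset.prod_le_prod' fun i _ => hJg i x
  · have h2 : Prod.mk x ⁻¹' S = ∅ := by
      ext c
      simp [S, hx]
    simp [h2]

/-- If `X` is independent of `Y` and `(X, Y)` is independent of `Z`, then `X` is independent of
`(Y, Z)`. -/
lemma ProbabilityTheory.IndepFun.prodMk_right_of_prodMk_left {α β γ : Type*} [MeasurableSpace α] [MeasurableSpace β]
    [MeasurableSpace γ] {X : Ω → α} {Y : Ω → β} {Z : Ω → γ} (hX : Measurable X)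
    (hY : Measurable Y) (hZ : Measurable Z) (h : IndepFun X Y P)
    (h' : IndepFun (fun ω => (X ω, Y ω)) Z P) : IndepFun X (fun ω => (Y ω, Z ω)) P := by
  have h1 := (indepFun_iff_map_prod_eq_prod_map_map hX.aemeasurable hY.aemeasurable).1 h
  have h2 := (indepFun_iff_map_prod_eq_prod_map_map (hX.prodMk hY).aemeasurable
    hZ.aemeasurable).1 h'
  have h3 : IndepFun Y Z P := h'.comp (φ := Prod.snd) (ψ := id) measurable_snd measurable_id
  have h4 := (indepFun_iff_map_prod_eq_prod_map_map hY.aemeasurable hZ.aemeasurable).1 h3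
  rw [indepFun_iff_map_prod_eq_prod_map_map hX.aemeasurable (hY.prodMk hZ).aemeasurable, h4]
  have := Measure.isProbabilityMeasure_map (μ := P) hX.aemeasurable
  have := Measure.isProbabilityMeasure_map (μ := P) hY.aemeasurable
  have := Measure.isProbabilityMeasure_map (μ := P) hZ.aemeasurable
  rw [← Measure.prodAssoc_prod, ← h1, ← h2,
    Measure.map_map MeasurableEquiv.prodAssoc.measurable ((hX.prodMk hY).prodMk hZ)]
  rfl

/-- The density is at most 1. So a clock falls in an interval with probability at most its length.
-/
lemma expMeasure_one_le_volume : expMeasure 1 ≤ volume := by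
  have h : (exponentialPDF 1) ≤ 1 := fun x => by
    rw [exponentialPDF_eq]
    refine ENNReal.ofReal_le_one.2 ?_
    split_ifs with hx
    · simpa using hx
    · exact zero_le_one
  calc expMeasure 1 = volume.withDensity (exponentialPDF 1) := rfl
    _ ≤ volume.withDensity 1 := withDensity_mono (ae_of_all _ h)
    _ = volume := withDensity_one

lemma expMeasure_one_Iic_zero : expMeasure 1 (Set.Iic 0) = 0 := by
  have : expMeasure 1 = volume.withDensity (exponentialPDF 1) := rfl
  rw [this, withDensity_apply _ measurableSet_Iic, ← restrict_Iio_eq_restrict_Iic,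
    setLIntegral_congr_fun measurableSet_Iio (g := fun _ => 0)
      fun x hx => exponentialPDF_of_neg hx]
  simp

end Marks

/-! ### Finite components -/

/-- In a locally finite graph, a vertex from which there are no long self-avoiding paths lies in a
finite component. -/
lemma SimpleGraph.finite_reachable {V : Type*} (G : SimpleGraph V)
    (hG : ∀ v, {w | G.Adj v w}.Finite) (v : V) (n : ℕ)
    (hn : ¬ ∃ k : Fin (n + 1) → V, Function.Injective k ∧ k 0 = v ∧
      ∀ i : Fin n, G.Adj (k i.castSucc) (k i.succ)) :
    {w | G.Reachable v w}.Finite := by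
  have hball : ∀ m : ℕ, {w | ∃ p : G.Walk v w, p.length = m}.Finite := by
    intro m
    induction m with
    | zero =>
      refine (Set.finite_singleton v).subset ?_
      rintro w ⟨p, hp⟩
      exact (SimpleGraph.Walk.eq_of_length_eq_zero hp).symm
    | succ m ih =>
      refine (ih.biUnion fun u _ => hG u).subset ?_
      rintro w ⟨p, hp⟩
      refine Set.mem_iUnion₂.2 ⟨p.getVert m, ⟨p.take m, ?_⟩, ?_⟩
      · rw [SimpleGraph.Walk.take_length]
        omega
      · have := p.adj_getVert_succ (i := m) (by omega)
        rwa [← hp, p.getVert_length] at this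
  -- A shortest walk is self-avoiding, so one of length at least `n` would begin with a forbidden
  -- path. The component is thus a finite union of finite spheres.
  refine ((Set.finite_lt_nat n).biUnion fun m _ => hball m).subset ?_
  intro w hw
  obtain ⟨p, hp⟩ := hw.exists_walk_length_eq_dist
  refine Set.mem_iUnion₂.2 ⟨p.length, ?_, p, rfl⟩
  by_contra hlt
  have hlt : n ≤ p.length := not_lt.1 hlt
  have hpath := (p.isPath_of_length_eq_dist hp).getVert_injOn
  refine hn ⟨fun i => p.getVert i, fun i j hij => ?_, by simp, fun i => ?_⟩
  · exact Fin.ext (hpath (show (i : ℕ) ≤ _ by omega) (show (j : ℕ) ≤ _ by omega) hij)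
  · exact p.adj_getVert_succ (i := i) (by omega)

/-! ### Birth times, and the intensity of connections -/

section Intensity

variable {d : ℕ}

/-- The intensity measure `lam · Lebesgue` on `ℝ^d × (0, ∞)`. -/
noncomputable abbrev birthIntensity (d : ℕ) (lam : ℝ) :
    Measure (EuclideanSpace ℝ (Fin d) × ℝ) :=
  ENNReal.ofReal lam •
    (volume : Measure (EuclideanSpace ℝ (Fin d))).prod (volume.restrict (Set.Ioi (0 : ℝ)))

instance (d : ℕ) (lam : ℝ) : SigmaFinite (birthIntensity d lam) := by
  have : birthIntensity d lam = lam.toNNReal • (volume : Measure (EuclideanSpace ℝ (Fin d))).prod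
    (volume.restrict (Set.Ioi (0 : ℝ))) := rfl
  rw [this]
  infer_instance

lemma birthIntensity_prod (lam : ℝ) (s : Set (EuclideanSpace ℝ (Fin d))) (t : Set ℝ) :
    birthIntensity d lam (s ×ˢ t) =
      ENNReal.ofReal lam * (volume s * (volume.restrict (Set.Ioi (0 : ℝ))) t) := by
  rw [birthIntensity, Measure.smul_apply, Measure.prod_prod, smul_eq_mul]

lemma birthIntensity_ball_prod_lt_top (lam r t : ℝ) :
    birthIntensity d lam (Metric.closedBall 0 r ×ˢ Set.Iic t) < ∞ := by
  rw [birthIntensity_prod, Measure.restrict_apply measurableSet_Iic, Set.inter_comm,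
    Set.Ioi_inter_Iic, Real.volume_Ioc]
  exact ENNReal.mul_lt_top ENNReal.ofReal_lt_top
    (ENNReal.mul_lt_top measure_closedBall_lt_top ENNReal.ofReal_lt_top)

variable {Ω : Type*} [MeasurableSpace Ω] {P : Measure Ω}
  {y : ℕ → Ω → EuclideanSpace ℝ (Fin d) × ℝ} {lam : ℝ}

lemma IsPoissonPointProcess.ae_birth_pos (h : IsPoissonPointProcess P y (birthIntensity d lam)) :
    ∀ᵐ ω ∂P, ∀ k, 0 < (y k ω).2 := by
  have h1 := h.ae_mem (B := Set.univ ×ˢ Set.Ioi 0) (MeasurableSet.univ.prod measurableSet_Ioi) ?_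
  · filter_upwards [h1] with ω hω k using (hω k).2
  · have : (Set.univ ×ˢ Set.Ioi 0 : Set (EuclideanSpace ℝ (Fin d) × ℝ))ᶜ =
        Set.univ ×ˢ Set.Iic 0 := by
      ext x; simp
    rw [this, birthIntensity_prod, Measure.restrict_apply measurableSet_Iic, Set.inter_comm,
      Set.Ioi_inter_Iic]
    simp

/-- In a bounded window cut into time cells of length `1 / m`, two points share a given cell with
probability of order `m⁻²`, and there are of order `m` cells. -/
lemma IsPoissonPointProcess.ae_birth_injective
    (h : IsPoissonPointProcess P y (birthIntensity d lam)) :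
    ∀ᵐ ω ∂P, Function.Injective fun k => (y k ω).2 := by
  have key : ∀ r : ℕ, P {ω | ∃ j k, j ≠ k ∧ (y j ω).2 = (y k ω).2 ∧
      (y j ω ∈ Metric.closedBall 0 (r : ℝ) ×ˢ Set.Ioc 0 (r : ℝ)) ∧
      (y k ω ∈ Metric.closedBall 0 (r : ℝ) ×ˢ Set.Ioc 0 (r : ℝ))} = 0 := by
    intro r
    set c : ℝ≥0∞ := ENNReal.ofReal lam * volume (Metric.closedBall (0 : EuclideanSpace ℝ (Fin d)) r)
    have hc : c ≠ ∞ := (ENNReal.mul_lt_top ENNReal.ofReal_lt_top measure_closedBall_lt_top).ne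
    set C : ℕ → ℕ → Set (EuclideanSpace ℝ (Fin d) × ℝ) := fun m i =>
      Metric.closedBall 0 (r : ℝ) ×ˢ Set.Icc ((i : ℝ) / m) ((i + 1) / m)
    have hCm : ∀ m i, MeasurableSet (C m i) := fun m i =>
      Metric.isClosed_closedBall.measurableSet.prod measurableSet_Icc
    have hC : ∀ m i, birthIntensity d lam (C m i) ≤ c * (m : ℝ≥0∞)⁻¹ := by
      intro m i
      rw [birthIntensity_prod, ← mul_assoc]
      refine mul_le_mul' le_rfl ((Measure.restrict_apply_le _ _).trans ?_)
      rw [Real.volume_Icc, ← sub_div, add_sub_cancel_left, one_div]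
      rcases Nat.eq_zero_or_pos m with rfl | hm
      · simp
      · rw [ENNReal.ofReal_inv_of_pos (by exact_mod_cast hm), ENNReal.ofReal_natCast]
    have hbound : ∀ m : ℕ, m ≠ 0 → P {ω | ∃ j k, j ≠ k ∧ (y j ω).2 = (y k ω).2 ∧
        (y j ω ∈ Metric.closedBall 0 (r : ℝ) ×ˢ Set.Ioc 0 (r : ℝ)) ∧
        (y k ω ∈ Metric.closedBall 0 (r : ℝ) ×ˢ Set.Ioc 0 (r : ℝ))} ≤
          c ^ 2 * (r + 1) * (m : ℝ≥0∞)⁻¹ := by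
      intro m hm
      have hm' : (0 : ℝ) < m := by positivity
      have hfin : c * (m : ℝ≥0∞)⁻¹ < ∞ :=
        ENNReal.mul_lt_top hc.lt_top (by simp [pos_iff_ne_zero, hm])
      -- The additional cell accommodates the birth time `r` itself, whose index is `m * r`.
      calc _ ≤ P (⋃ i ∈ Finset.range (m * r + 1),
            {ω | ∃ j k, j ≠ k ∧ y j ω ∈ C m i ∧ y k ω ∈ C m i}) := by
            refine measure_mono ?_
            rintro ω ⟨j, k, hjk, heq, hj, hk⟩
            have h0 : 0 ≤ m * (y j ω).2 := mul_nonneg hm'.le hj.2.1.le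
            refine Set.mem_iUnion₂.2 ⟨⌊m * (y j ω).2⌋₊, ?_, j, k, hjk, ⟨hj.1, ?_⟩, hk.1, ?_⟩
            · rw [Finset.mem_range]
              refine Nat.lt_succ_of_le (Nat.floor_le_of_le ?_)
              push_cast
              exact mul_le_mul_of_nonneg_left hj.2.2 hm'.le
            · rw [Set.mem_Icc, div_le_iff₀ hm', le_div_iff₀ hm', mul_comm _ (m : ℝ)]
              exact ⟨Nat.floor_le h0, (Nat.lt_floor_add_one _).le⟩
            · rw [← heq, Set.mem_Icc, div_le_iff₀ hm', le_div_iff₀ hm', mul_comm _ (m : ℝ)]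
              exact ⟨Nat.floor_le h0, (Nat.lt_floor_add_one _).le⟩
        _ ≤ ∑ i ∈ Finset.range (m * r + 1), (c * (m : ℝ≥0∞)⁻¹) ^ 2 := by
            refine (measure_biUnion_finset_le _ _).trans (Finset.sum_le_sum fun i _ => ?_)
            refine (h.measure_pair_le (hCm m i) ((hC m i).trans_lt hfin)).trans ?_
            exact pow_le_pow_left₀ zero_le (hC m i) 2
        _ = c ^ 2 * ((m * r + 1 : ℕ) * (m : ℝ≥0∞)⁻¹) * (m : ℝ≥0∞)⁻¹ := by
            rw [Finset.sum_const, Finset.card_range, nsmul_eq_mul]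
            ring
        _ ≤ _ := by
            gcongr
            rw [← ENNReal.div_eq_inv_mul.trans (mul_comm _ _)]
            refine ENNReal.div_le_of_le_mul ?_
            norm_cast
            have : 1 ≤ m := Nat.one_le_iff_ne_zero.2 hm
            nlinarith
    have h1 : Tendsto (fun m : ℕ => c ^ 2 * (r + 1) * (m : ℝ≥0∞)⁻¹) atTop
        (nhds (c ^ 2 * (r + 1) * 0)) :=
      ENNReal.Tendsto.const_mul ENNReal.tendsto_inv_nat_nhds_zero
        (.inr (ENNReal.mul_ne_top (ENNReal.pow_ne_top hc) (by simp)))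
    rw [mul_zero] at h1
    refine le_antisymm (ge_of_tendsto h1 ?_) zero_le
    filter_upwards [eventually_ne_atTop 0] with m hm using hbound m hm
  have h2 : ∀ᵐ ω ∂P, ∀ r : ℕ, ¬ ∃ j k, j ≠ k ∧ (y j ω).2 = (y k ω).2 ∧
      (y j ω ∈ Metric.closedBall 0 (r : ℝ) ×ˢ Set.Ioc 0 (r : ℝ)) ∧
      (y k ω ∈ Metric.closedBall 0 (r : ℝ) ×ˢ Set.Ioc 0 (r : ℝ)) :=
    ae_all_iff.2 fun r => measure_eq_zero_iff_ae_notMem.1 (key r)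
  filter_upwards [h2, h.ae_birth_pos] with ω h2 h3 j k hjk
  by_contra hne
  obtain ⟨r, hr⟩ := exists_nat_ge (max (max ‖(y j ω).1‖ ‖(y k ω).1‖) (max (y j ω).2 (y k ω).2))
  simp only [max_le_iff] at hr
  exact h2 r ⟨j, k, hne, hjk, ⟨by simpa using hr.1.1, h3 j, hr.2.1⟩,
    ⟨by simpa using hr.1.2, h3 k, hr.2.2⟩⟩

/-- The bound on the probability that points at `x` and `x'`, born before `t`, connect in a given
time interval of length `ε`. -/
noncomputable def connectBound (f : ℝ → ℝ) (t ε : ℝ) (x x' : EuclideanSpace ℝ (Fin d) × ℝ) :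
    ℝ≥0∞ :=
  (Set.Iic t).indicator 1 x'.2 * ENNReal.ofReal (2 * ε * f ‖x.1 - x'.1‖)

lemma measurable_connectBound {f : ℝ → ℝ} (hf : Measurable f) (t ε : ℝ) :
    Measurable (Function.uncurry (connectBound (d := d) f t ε)) := by
  unfold connectBound Function.uncurry
  refine Measurable.mul ?_ ?_
  · exact (measurable_one.indicator measurableSet_Iic).comp (by fun_prop)
  · fun_prop

/-- Birth times in `(0, t]` and locations factorise, and translation invariance makes the value
independent of `x`, as the path estimate requires. -/
lemma lintegral_connectBound {f : ℝ → ℝ} (hf : Measurable f) (t : ℝ) {ε : ℝ} (hε : 0 ≤ ε)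
    (lam : ℝ) (x : EuclideanSpace ℝ (Fin d) × ℝ) :
    ∫⁻ x', connectBound f t ε x x' ∂(birthIntensity d lam) =
      ENNReal.ofReal (2 * ε) * (ENNReal.ofReal lam * ENNReal.ofReal t *
        ∫⁻ v : EuclideanSpace ℝ (Fin d), ENNReal.ofReal (f ‖v‖)) := by
  have h1 : Measurable fun v : EuclideanSpace ℝ (Fin d) => ENNReal.ofReal (f ‖x.1 - v‖) := by
    fun_prop
  have h2 : ∀ x' : EuclideanSpace ℝ (Fin d) × ℝ, connectBound f t ε x x' =
      ENNReal.ofReal (2 * ε) * (ENNReal.ofReal (f ‖x.1 - x'.1‖) * (Set.Iic t).indicator 1 x'.2) := by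
    intro x'
    rw [connectBound, ENNReal.ofReal_mul (by positivity)]
    ring
  have h3 : Measurable fun b : ℝ => ((Set.Iic t).indicator 1 b : ℝ≥0∞) :=
    measurable_one.indicator measurableSet_Iic
  have h4 : Measurable fun x' : EuclideanSpace ℝ (Fin d) × ℝ =>
      ENNReal.ofReal (f ‖x.1 - x'.1‖) * ((Set.Iic t).indicator 1 x'.2 : ℝ≥0∞) :=
    (h1.comp measurable_fst).mul (h3.comp measurable_snd)
  simp_rw [h2]
  rw [lintegral_const_mul _ h4, lintegral_smul_measure, lintegral_prod_mul h1.aemeasurable h3.aemeasurable,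
    lintegral_indicator_one measurableSet_Iic, Measure.restrict_apply measurableSet_Iic,
    Set.inter_comm, Set.Ioi_inter_Iic, Real.volume_Ioc, sub_zero, smul_eq_mul,
    lintegral_sub_left_eq_self (fun v : EuclideanSpace ℝ (Fin d) => ENNReal.ofReal (f ‖v‖)) x.1]
  ring

end Intensity

/-- There is no infinite decreasing chain of connection times if, within short time slices, there
are no long self-avoiding paths. -/
lemma not_exists_strictAnti_of_paths {V : Type*} {T : V → V → ℝ≥0∞}
    (hsymm : ∀ p q, T p q = T q p) (hself : ∀ p, T p p = ∞)
    (hfin : ∀ p, ∀ t : ℝ≥0, {q | T p q ≤ t}.Finite)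
    (hpath : ∀ t : ℕ, ∃ ε : ℝ, 0 < ε ∧ ∀ m : ℕ, ∀ v, ∃ n : ℕ, ¬ ∃ k : Fin (n + 1) → V,
      Function.Injective k ∧ k 0 = v ∧ ∀ i : Fin n, T (k i.castSucc) (k i.succ) ≤ t ∧
        m * ε ≤ (T (k i.castSucc) (k i.succ)).toReal ∧
        (T (k i.castSucc) (k i.succ)).toReal ≤ m * ε + ε) :
    ¬ ∃ s : ℕ → V, StrictAnti fun n => T (s n) (s (n + 1)) := by
  rintro ⟨s, hs⟩
  -- The first connection time is dropped because it may be infinite.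
  set τ : ℕ → ℝ := fun n => (T (s (n + 1)) (s (n + 2))).toReal
  have hlt : ∀ n, T (s (n + 1)) (s (n + 2)) < ∞ := fun n =>
    (hs (Nat.lt_succ_self n)).trans_le le_top
  have hτ : StrictAnti τ := fun i j hij =>
    (ENNReal.toReal_lt_toReal (hlt j).ne (hlt i).ne).2 (hs (by omega))
  have hbdd : BddBelow (Set.range τ) := ⟨0, by rintro _ ⟨n, rfl⟩; exact ENNReal.toReal_nonneg⟩
  have hlim := tendsto_atTop_ciInf hτ.antitone hbdd
  set l := ⨅ n, τ n
  have hl : 0 ≤ l := le_ciInf fun n => ENNReal.toReal_nonneg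
  obtain ⟨t, ht⟩ := exists_nat_ge (τ 0)
  obtain ⟨ε, hε, hpath⟩ := hpath t
  -- The slice containing the limit `l`. The times decrease to `l`, so they eventually lie in this
  -- slice.
  set m := ⌊l / ε⌋₊
  have hm1 : m * ε ≤ l := (le_div_iff₀ hε).1 (Nat.floor_le (by positivity))
  have hm2 : l < m * ε + ε := by
    have := (div_lt_iff₀ hε).1 (Nat.lt_floor_add_one (l / ε))
    linarith
  obtain ⟨N, hN⟩ := eventually_atTop.1 (hlim.eventually_lt_const hm2)
  have hself' : ∀ p, ¬ T p p ≤ (t : ℝ≥0∞) := fun p => by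
    rw [hself, top_le_iff]
    exact ENNReal.natCast_ne_top t
  let G : SimpleGraph V :=
    { Adj := fun p q => T p q ≤ t ∧ m * ε ≤ (T p q).toReal ∧ (T p q).toReal ≤ m * ε + ε
      symm := ⟨fun p q h => by rwa [hsymm q p]⟩
      loopless := ⟨fun p h => hself' p h.1⟩ }
  obtain ⟨n, hn⟩ := hpath m (s (N + 1))
  have hreach := G.finite_reachable (fun v => (hfin v t).subset fun w hw => by
    simpa using hw.1) (s (N + 1)) n hn
  have hadj : ∀ k, G.Adj (s (N + k + 1)) (s (N + k + 2)) := by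
    intro k
    refine ⟨?_, hm1.trans (ciInf_le hbdd _), (hN (N + k) (by omega)).le⟩
    have h1 : τ (N + k) ≤ t := (hτ.antitone (Nat.zero_le _)).trans ht
    rw [← ENNReal.ofReal_toReal (hlt (N + k)).ne, ← ENNReal.ofReal_natCast]
    exact ENNReal.ofReal_le_ofReal h1
  have hmem : ∀ k, G.Reachable (s (N + 1)) (s (N + k + 1)) := by
    intro k
    induction k with
    | zero => exact .rfl
    | succ k ih => exact ih.trans (hadj k).reachable
  have hinj : Function.Injective fun k => τ (N + k) := fun i j hij => by
    have := hτ.injective hij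
    omega
  -- Infinitely many distinct times would be attained on pairs from a finite component.
  refine Set.infinite_range_of_injective hinj (((hreach.prod hreach).image
    fun p => (T p.1 p.2).toReal).subset ?_)
  rintro _ ⟨k, rfl⟩
  exact ⟨(s (N + k + 1), s (N + k + 2)), ⟨hmem k, hmem (k + 1)⟩, rfl⟩

/-! ### Connection events in terms of points and clocks -/

section System

variable {d : ℕ}

/-- The space of configurations of points. -/
abbrev PtSpace (d : ℕ) : Type :=
  (ℕ∞ × (ℕ → EuclideanSpace ℝ (Fin d))) × (ℕ → EuclideanSpace ℝ (Fin d) × ℝ)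

/-- Location and birth time of the point with a given label. -/
def PtSpace.pos (x : PtSpace d) : PtLabel → EuclideanSpace ℝ (Fin d) × ℝ
  | Sum.inl k => (x.1.2 k, 0)
  | Sum.inr k => x.2 k

lemma measurable_pos (p : PtLabel) : Measurable fun x : PtSpace d => x.pos p := by
  cases p with
  | inl k => exact Measurable.prodMk (by fun_prop) measurable_const
  | inr k => change Measurable fun x : PtSpace d => x.2 k; fun_prop

/-- The configuration of points of a realization. -/
def Realization.points (c : Realization d) : PtSpace d := ((c.numZ, c.z), c.y)

lemma Realization.pos_points (c : Realization d) (p : PtLabel) :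
    c.points.pos p = (c.loc p, c.birth p) := by
  cases p <;> rfl

/-- The configurations of points, and clocks of the pair `p, q`, for which `p` and `q` are born
before `t` and connect in the time interval `[a, a + ε]`. -/
def connectSet (f : ℝ → ℝ) (t a ε : ℝ) (p q : PtLabel) : Set (PtSpace d × ℝ) :=
  {w | (w.1.pos q).2 ≤ t ∧ f ‖(w.1.pos p).1 - (w.1.pos q).1‖ ≠ 0 ∧
    max (w.1.pos p).2 (w.1.pos q).2 + w.2 / (2 * f ‖(w.1.pos p).1 - (w.1.pos q).1‖) ∈
      Set.Icc a (a + ε)}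

lemma measurableSet_connectSet {f : ℝ → ℝ} (hf : Measurable f) (t a ε : ℝ) (p q : PtLabel) :
    MeasurableSet (connectSet (d := d) f t a ε p q) := by
  have hp : Measurable fun w : PtSpace d × ℝ => w.1.pos p := (measurable_pos p).comp measurable_fst
  have hq : Measurable fun w : PtSpace d × ℝ => w.1.pos q := (measurable_pos q).comp measurable_fst
  have h1 : Measurable fun w : PtSpace d × ℝ => (w.1.pos q).2 := hq.snd
  have h2 : Measurable fun w : PtSpace d × ℝ => f ‖(w.1.pos p).1 - (w.1.pos q).1‖ :=
    hf.comp (hp.fst.sub hq.fst).norm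
  have h3 : Measurable fun w : PtSpace d × ℝ => max (w.1.pos p).2 (w.1.pos q).2 +
      w.2 / (2 * f ‖(w.1.pos p).1 - (w.1.pos q).1‖) :=
    (hp.snd.max hq.snd).add (measurable_snd.div (h2.const_mul 2))
  exact (h1 measurableSet_Iic).inter ((h2 (measurableSet_singleton 0).compl).inter
    (h3 measurableSet_Icc))

/-- Given the points, the clock is confined to an interval whose length is ε times the rate 2f. -/
lemma expMeasure_connectSet_le {f : ℝ → ℝ} (hf : ∀ r, 0 ≤ r → 0 ≤ f r) (t a ε : ℝ) (p q : PtLabel)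
    (x : PtSpace d) :
    expMeasure 1 {c | (x, c) ∈ connectSet f t a ε p q} ≤
      connectBound f t ε (x.pos p) (x.pos q) := by
  set r := f ‖(x.pos p).1 - (x.pos q).1‖
  set b := max (x.pos p).2 (x.pos q).2
  by_cases h : (x.pos q).2 ≤ t ∧ r ≠ 0
  · have hr : 0 < r := lt_of_le_of_ne (hf _ (norm_nonneg _)) h.2.symm
    refine (expMeasure_one_le_volume _).trans ?_
    have h1 : {c | (x, c) ∈ connectSet f t a ε p q} ⊆
        Set.Icc (2 * r * (a - b)) (2 * r * (a - b) + 2 * ε * r) := by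
      rintro c ⟨-, -, h1, h2⟩
      change a ≤ b + c / (2 * r) at h1
      change b + c / (2 * r) ≤ a + ε at h2
      have h3 : a - b ≤ c / (2 * r) := by linarith
      have h4 : c / (2 * r) ≤ a - b + ε := by linarith
      rw [le_div_iff₀ (by positivity)] at h3
      rw [div_le_iff₀ (by positivity)] at h4
      exact ⟨by linarith, by linarith⟩
    refine (measure_mono h1).trans ?_
    rw [Real.volume_Icc, add_sub_cancel_left, connectBound,
      Set.indicator_of_mem (show (x.pos q).2 ∈ Set.Iic t from h.1), Pi.one_apply, one_mul]
  · have : {c | (x, c) ∈ connectSet f t a ε p q} = ∅ := by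
      ext c
      simp only [Set.mem_ofPred_eq, Set.mem_empty_iff_false, iff_false]
      exact fun hc => h ⟨hc.1, hc.2.1⟩
    rw [this]
    simp

lemma Realization.mem_connectSet {c : Realization d} {f : ℝ → ℝ} (hf : ∀ r, 0 ≤ r → 0 ≤ f r)
    {p q : PtLabel} (hq : 0 ≤ c.birth q) (hc : 0 < c.clock s(p, q)) {t a ε : ℝ} (ht0 : 0 ≤ t)
    (ht : c.T f p q ≤ ENNReal.ofReal t) (ha : a ≤ (c.T f p q).toReal)
    (hε : (c.T f p q).toReal ≤ a + ε) :
    c.birth q ≤ t ∧ (c.points, c.clock s(p, q)) ∈ connectSet f t a ε p q := by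
  have hf0 : f ‖c.loc p - c.loc q‖ ≠ 0 := by
    intro h
    rw [T, if_pos h, top_le_iff] at ht
    exact ENNReal.ofReal_ne_top ht
  have hr : 0 < f ‖c.loc p - c.loc q‖ := lt_of_le_of_ne (hf _ (norm_nonneg _)) hf0.symm
  have h1 : 0 ≤ max (c.birth p) (c.birth q) := hq.trans (le_max_right _ _)
  have h2 : 0 < c.clock s(p, q) / (2 * f ‖c.loc p - c.loc q‖) := by positivity
  rw [T, if_neg hf0] at ht ha hε
  rw [ENNReal.toReal_ofReal (by linarith)] at ha hε
  rw [ENNReal.ofReal_le_ofReal_iff ht0] at ht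
  have hb : c.birth q ≤ t := by
    have := le_max_right (c.birth p) (c.birth q)
    linarith
  refine ⟨hb, ?_⟩
  simp only [connectSet, Set.mem_ofPred_eq, pos_points]
  exact ⟨hb, hf0, ha, hε⟩

/-- This gives the edges of a self-avoiding path independent clocks. A coincidence with reversed
orientation would force both `i = j + 1` and `i + 1 = j`. -/
lemma pathEdges_injective {V : Type*} {n : ℕ} {k : Fin (n + 1) → V} (hk : Function.Injective k) :
    Function.Injective fun i : Fin n => s(k i.castSucc, k i.succ) := by
  intro i j h
  rcases Sym2.eq_iff.1 h with ⟨h1, -⟩ | ⟨h1, h2⟩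
  · exact Fin.castSucc_injective _ (hk h1)
  · have e1 := congrArg Fin.val (hk h1)
    have e2 := congrArg Fin.val (hk h2)
    simp at e1 e2
    omega

end System

lemma Realization.T_symm {d : ℕ} (c : Realization d) (f : ℝ → ℝ) (p q : PtLabel) :
    c.T f p q = c.T f q p := by
  simp only [T, Sym2.eq_swap (a := p), norm_sub_rev (c.loc p), max_comm (c.birth p)]

/-! ### First moment bounds for paths of connections -/

namespace IsRandomSystem

variable {Ω : Type*} [MeasurableSpace Ω] {P : Measure Ω} {d : ℕ} {lam : ℝ} {R : Ω → Realization d}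

lemma measurable_points (hR : IsRandomSystem P lam R) : Measurable fun ω => (R ω).points :=
  (hR.measurable_numZ.prodMk (measurable_pi_lambda _ hR.measurable_z)).prodMk
    (measurable_pi_lambda _ hR.poisson.measurable)

lemma iIndepFun_clock (hR : IsRandomSystem P lam R) :
    iIndepFun (fun s ω => (R ω).clock s) P :=
  hR.iIndepFun_mark.comp (fun _ => Prod.fst) fun _ => measurable_fst

lemma indepFun_points_clock (hR : IsRandomSystem P lam R) :
    IndepFun (fun ω => (R ω).points) (fun ω s => (R ω).clock s) P :=
  hR.indep_points_marks.comp (φ := id)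
    (ψ := fun (c : Sym2 PtLabel → ℝ × Bool) s => (c s).1) measurable_id (by fun_prop)

lemma ae_birth_nonneg (hR : IsRandomSystem P lam R) : ∀ᵐ ω ∂P, ∀ p, 0 ≤ (R ω).birth p := by
  filter_upwards [hR.poisson.ae_birth_pos] with ω hω p
  cases p with
  | inl k => exact le_rfl
  | inr k => exact (hω k).le

lemma map_clock (hR : IsRandomSystem P lam R) (hc : ∀ s, Measurable fun ω => (R ω).clock s)
    (hb : ∀ s, Measurable fun ω => (R ω).coin s) (s : Sym2 PtLabel) :
    P.map (fun ω => (R ω).clock s) = expMeasure 1 := by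
  have := isProbabilityMeasure_expMeasure one_pos
  have h := (hR.hasLaw_mark s).map_eq
  have h1 := congrArg (Measure.map Prod.fst) h
  rw [Measure.map_map measurable_fst ((hc s).prodMk (hb s)), Measure.map_fst_prod, measure_univ,
    one_smul] at h1
  exact h1

lemma map_coin (hR : IsRandomSystem P lam R) (hc : ∀ s, Measurable fun ω => (R ω).clock s)
    (hb : ∀ s, Measurable fun ω => (R ω).coin s) (s : Sym2 PtLabel) :
    P.map (fun ω => (R ω).coin s) = (PMF.uniformOfFintype Bool).toMeasure := by
  have := isProbabilityMeasure_expMeasure one_pos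
  have h := (hR.hasLaw_mark s).map_eq
  have h1 := congrArg (Measure.map Prod.snd) h
  rw [Measure.map_map measurable_snd ((hc s).prodMk (hb s)), Measure.map_snd_prod, measure_univ,
    one_smul] at h1
  exact h1

lemma ae_clock_pos (hR : IsRandomSystem P lam R) (hc : ∀ s, Measurable fun ω => (R ω).clock s)
    (hb : ∀ s, Measurable fun ω => (R ω).coin s) : ∀ᵐ ω ∂P, ∀ s, 0 < (R ω).clock s := by
  refine ae_all_iff.2 fun s => ?_
  have h := expMeasure_one_Iic_zero
  rw [← hR.map_clock hc hb s, Measure.map_apply (hc s) measurableSet_Iic] at h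
  filter_upwards [measure_eq_zero_iff_ae_notMem.1 h] with ω hω using not_le.1 hω

lemma ae_T_pos {f : ℝ → ℝ} (hf : ∀ r, 0 ≤ r → 0 ≤ f r) (hR : IsRandomSystem P lam R)
    (hc : ∀ s, Measurable fun ω => (R ω).clock s)
    (hb : ∀ s, Measurable fun ω => (R ω).coin s) : ∀ᵐ ω ∂P, ∀ p q, 0 < (R ω).T f p q := by
  filter_upwards [hR.ae_clock_pos hc hb, hR.ae_birth_nonneg] with ω h1 h2 p q
  unfold Realization.T
  split_ifs with h
  · exact ENNReal.zero_lt_top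
  · have h3 := lt_of_le_of_ne (hf _ (norm_nonneg _)) (Ne.symm h)
    have h4 := (h2 q).trans (le_max_right ((R ω).birth p) _)
    have h5 := h1 s(p, q)
    rw [ENNReal.ofReal_pos]
    positivity

variable [IsProbabilityMeasure P] {f : ℝ → ℝ}

lemma measure_path_le (hR : IsRandomSystem P lam R)
    (hc : ∀ s, Measurable fun ω => (R ω).clock s) (hb : ∀ s, Measurable fun ω => (R ω).coin s)
    (hfm : Measurable f) (hf : ∀ r, 0 ≤ r → 0 ≤ f r) (t a ε : ℝ) {n : ℕ}
    {k : Fin (n + 1) → PtLabel} (hk : Function.Injective k) {A : Set (PtSpace d)}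
    (hA : MeasurableSet A) :
    P {ω | (R ω).points ∈ A ∧ ∀ i : Fin n, ((R ω).points, (R ω).clock s(k i.castSucc, k i.succ)) ∈
      connectSet f t a ε (k i.castSucc) (k i.succ)} ≤
    ∫⁻ ω, A.indicator 1 (R ω).points * ∏ i : Fin n, connectBound f t ε
      ((R ω).points.pos (k i.castSucc)) ((R ω).points.pos (k i.succ)) ∂P := by
  have := isProbabilityMeasure_expMeasure one_pos
  refine measure_marks_le (C := fun s ω => (R ω).clock s) (s := fun i : Fin n => s(k i.castSucc, k i.succ))
    (J := fun i : Fin n => connectSet f t a ε (k i.castSucc) (k i.succ))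
    (g := fun i x => connectBound f t ε (x.pos (k i.castSucc)) (x.pos (k i.succ)))
    hR.measurable_points hc (hR.map_clock hc hb)
    hR.iIndepFun_clock hR.indepFun_points_clock (pathEdges_injective hk)
    (fun i => measurableSet_connectSet hfm _ _ _ _ _)
    (fun i => (measurable_connectBound hfm t ε).comp ((measurable_pos _).prodMk (measurable_pos _)))
    (fun i x => expMeasure_connectSet_le hf _ _ _ _ _ x) hA

/-- The event that the points of `Ψ` with labels `k 0, k 1, …` form a path all of whose connections
take place in the time interval `[a, a + ε]`, starting in a given ball and born before `t`. -/
def pathEvent (R : Ω → Realization d) (f : ℝ → ℝ) (r t a ε : ℝ) {n : ℕ} (k : Fin (n + 1) → ℕ) :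
    Set Ω :=
  {ω | (R ω).points.pos (Sum.inr (k 0)) ∈ Metric.closedBall 0 r ×ˢ Set.Iic t ∧ ∀ i : Fin n,
    ((R ω).points, (R ω).clock s(Sum.inr (k i.castSucc), Sum.inr (k i.succ))) ∈
      connectSet f t a ε (Sum.inr (k i.castSucc)) (Sum.inr (k i.succ))}

/-- The expected number of connections of a point of `Ψ` in a time interval of length `ε`. -/
noncomputable def meanDegree (d : ℕ) (lam : ℝ) (f : ℝ → ℝ) (t ε : ℝ) : ℝ≥0∞ :=
  ENNReal.ofReal (2 * ε) * (ENNReal.ofReal lam * ENNReal.ofReal t *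
    ∫⁻ v : EuclideanSpace ℝ (Fin d), ENNReal.ofReal (f ‖v‖))

/-- Integrating out the clocks leaves a function of the points; the factorial moment bound turns the
sum over distinct labels into an integral against the product intensity, where each edge costs one
factor `meanDegree`. -/
lemma tsum_pathEvent_le (hR : IsRandomSystem P lam R)
    (hc : ∀ s, Measurable fun ω => (R ω).clock s) (hb : ∀ s, Measurable fun ω => (R ω).coin s)
    (hfm : Measurable f) (hf : ∀ r, 0 ≤ r → 0 ≤ f r) (r t a : ℝ) {ε : ℝ} (hε : 0 ≤ ε) (n : ℕ) :
    ∑' k : {k : Fin (n + 1) → ℕ // Function.Injective k}, P (pathEvent R f r t a ε k.1) ≤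
      meanDegree d lam f t ε ^ n * birthIntensity d lam (Metric.closedBall 0 r ×ˢ Set.Iic t) := by
  have hB : MeasurableSet (Metric.closedBall 0 r ×ˢ Set.Iic t :
      Set (EuclideanSpace ℝ (Fin d) × ℝ)) :=
    Metric.isClosed_closedBall.measurableSet.prod measurableSet_Iic
  have hBm := (measurable_one (α := ℝ≥0∞)).indicator hB
  set G : (Fin (n + 1) → EuclideanSpace ℝ (Fin d) × ℝ) → ℝ≥0∞ := fun x =>
    (Metric.closedBall 0 r ×ˢ Set.Iic t : Set (EuclideanSpace ℝ (Fin d) × ℝ)).indicator 1 (x 0) *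
      ∏ i : Fin n, connectBound f t ε (x i.castSucc) (x i.succ)
  have hG : Measurable G := (hBm.comp (measurable_pi_apply 0)).mul
    (Finset.measurable_fun_prod _ fun i _ =>
      have hp : Measurable fun x : Fin (n + 1) → EuclideanSpace ℝ (Fin d) × ℝ =>
        (x i.castSucc, x i.succ) := by fun_prop
      (measurable_connectBound hfm t ε).comp hp)
  calc _ ≤ ∑' k : {k : Fin (n + 1) → ℕ // Function.Injective k},
        ∫⁻ ω, G (fun i => (R ω).y (k.1 i)) ∂P := ENNReal.tsum_le_tsum fun k =>
          hR.measure_path_le hc hb hfm hf t a ε (Sum.inr_injective.comp k.2)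
            ((measurable_pos (Sum.inr (k.1 0))) hB)
    _ ≤ ∫⁻ x, G x ∂(Measure.pi fun _ => birthIntensity d lam) :=
        hR.poisson.tsum_lintegral_le measurable_snd hR.poisson.ae_birth_injective hG
    _ ≤ _ := lintegral_path_le (measurable_connectBound hfm t ε)
        (fun x => (lintegral_connectBound hfm t hε lam x).le) n hBm
    _ = _ := by rw [lintegral_indicator_one hB]; rfl

lemma meanDegree_lt_top (hf_int : Integrable (fun x : EuclideanSpace ℝ (Fin d) => f ‖x‖))
    (t ε : ℝ) : meanDegree d lam f t ε < ∞ :=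
  ENNReal.mul_lt_top ENNReal.ofReal_lt_top (ENNReal.mul_lt_top
    (ENNReal.mul_lt_top ENNReal.ofReal_lt_top ENNReal.ofReal_lt_top) hf_int.lintegral_lt_top)

lemma exists_meanDegree_le_half (hf_int : Integrable (fun x : EuclideanSpace ℝ (Fin d) => f ‖x‖))
    (t : ℝ) : ∃ ε : ℝ, 0 < ε ∧ meanDegree d lam f t ε ≤ 2⁻¹ := by
  set K := ENNReal.ofReal lam * ENNReal.ofReal t *
    ∫⁻ v : EuclideanSpace ℝ (Fin d), ENNReal.ofReal (f ‖v‖)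
  have hK : K ≠ ∞ := (ENNReal.mul_lt_top
    (ENNReal.mul_lt_top ENNReal.ofReal_lt_top ENNReal.ofReal_lt_top) hf_int.lintegral_lt_top).ne
  have hK0 : 0 ≤ K.toReal := ENNReal.toReal_nonneg
  -- Then 2εK = K / (2(K + 1)); the added 1 takes care of `K = 0`.
  refine ⟨1 / (4 * (K.toReal + 1)), by positivity, ?_⟩
  change ENNReal.ofReal _ * K ≤ _
  rw [← ENNReal.ofReal_toReal hK, ← ENNReal.ofReal_mul (by positivity),
    ← ENNReal.ofReal_ofNat 2, ← ENNReal.ofReal_inv_of_pos two_pos]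
  refine ENNReal.ofReal_le_ofReal ?_
  rw [ENNReal.toReal_ofReal hK0]
  have : 2 * (1 / (4 * (K.toReal + 1))) * K.toReal = 2⁻¹ * (K.toReal / (K.toReal + 1)) := by
    field_simp
    ring
  rw [this]
  have h2 : K.toReal / (K.toReal + 1) ≤ 1 := (div_le_one (by positivity)).2 (by linarith)
  linarith

/-- Points of `Ψ` have finitely many connections to points of `Ψ` in bounded time. -/
lemma ae_finite_degree (hR : IsRandomSystem P lam R)
    (hc : ∀ s, Measurable fun ω => (R ω).clock s) (hb : ∀ s, Measurable fun ω => (R ω).coin s)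
    (hfm : Measurable f) (hf : ∀ r, 0 ≤ r → 0 ≤ f r)
    (hf_int : Integrable (fun x : EuclideanSpace ℝ (Fin d) => f ‖x‖)) :
    ∀ᵐ ω ∂P, ∀ j : ℕ, ∀ t : ℕ, {k : ℕ | (R ω).T f (Sum.inr j) (Sum.inr k) ≤ t}.Finite := by
  have h1 : ∀ᵐ ω ∂P, ∀ r t : ℕ,
      {k : {k : Fin 2 → ℕ // Function.Injective k} | ω ∈ pathEvent R f r t 0 t k.1}.Finite := by
    -- Borel–Cantelli for paths of a single connection, with the slice `[0, t]`.
    refine ae_all_iff.2 fun r => ae_all_iff.2 fun t => ae_finite_setOfPred_mem (ne_of_lt ?_)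
    refine (hR.tsum_pathEvent_le hc hb hfm hf r t 0 (Nat.cast_nonneg t) 1).trans_lt ?_
    exact ENNReal.mul_lt_top (ENNReal.pow_lt_top (meanDegree_lt_top hf_int _ _))
      (birthIntensity_ball_prod_lt_top _ _ _)
  filter_upwards [h1, hR.ae_clock_pos hc hb, hR.ae_birth_nonneg] with ω h1 h2 h3 j t
  obtain ⟨r, hr⟩ := exists_nat_ge ‖((R ω).y j).1‖
  refine ((((h1 r t).image fun k => k.1 1).insert j)).subset fun k hk => ?_
  by_cases hkj : k = j
  · exact .inl hkj
  have hk : (R ω).T f (Sum.inr j) (Sum.inr k) ≤ t := hk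
  have hk' : (R ω).T f (Sum.inr j) (Sum.inr k) ≤ ENNReal.ofReal t := by simpa using hk
  have htr : ((R ω).T f (Sum.inr j) (Sum.inr k)).toReal ≤ t :=
    ENNReal.toReal_le_of_le_ofReal (Nat.cast_nonneg t) hk'
  have h4 := Realization.mem_connectSet hf (h3 _) (h2 _) (Nat.cast_nonneg t) hk'
    ENNReal.toReal_nonneg (by simpa using htr)
  have hsym := (R ω).T_symm f (Sum.inr k) (Sum.inr j)
  -- The reversed pair is used to see that `j` is born before `t`.
  have h5 := Realization.mem_connectSet (c := R ω) (p := Sum.inr k) (q := Sum.inr j) hf (h3 _)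
    (h2 _) (Nat.cast_nonneg t) (hsym ▸ hk') ENNReal.toReal_nonneg
    (ε := t) (by rw [hsym]; simpa using htr)
  refine .inr ⟨⟨![j, k], ?_⟩, ⟨⟨?_, h5.1⟩, ?_⟩, rfl⟩
  · intro a b
    fin_cases a <;> fin_cases b <;> simp [hkj, Ne.symm hkj]
  · simpa [PtSpace.pos, Realization.points] using hr
  · intro i
    have hi : i = 0 := Subsingleton.elim _ _
    subst hi
    exact h4.2

/-- Within short time slices there are no long self-avoiding paths of connections of points of
`Ψ`. -/
lemma ae_no_long_path (hR : IsRandomSystem P lam R)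
    (hc : ∀ s, Measurable fun ω => (R ω).clock s) (hb : ∀ s, Measurable fun ω => (R ω).coin s)
    (hfm : Measurable f) (hf : ∀ r, 0 ≤ r → 0 ≤ f r)
    (hf_int : Integrable (fun x : EuclideanSpace ℝ (Fin d) => f ‖x‖)) :
    ∀ᵐ ω ∂P, ∀ t : ℕ, ∃ ε : ℝ, 0 < ε ∧ ∀ m : ℕ, ∀ v : ℕ, ∃ n : ℕ,
       ¬ ∃ k : Fin (n + 1) → ℕ, Function.Injective k ∧ k 0 = v ∧ ∀ i : Fin n,
        (R ω).T f (Sum.inr (k i.castSucc)) (Sum.inr (k i.succ)) ≤ t ∧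
        m * ε ≤ ((R ω).T f (Sum.inr (k i.castSucc)) (Sum.inr (k i.succ))).toReal ∧
        ((R ω).T f (Sum.inr (k i.castSucc)) (Sum.inr (k i.succ))).toReal ≤ m * ε + ε := by
  choose ε hε hhalf using fun t : ℕ => exists_meanDegree_le_half (lam := lam) hf_int t
  have h1 : ∀ᵐ ω ∂P, ∀ t r m : ℕ, ∃ n : ℕ,
      ¬ ∃ k : {k : Fin (n + 1) → ℕ // Function.Injective k},
        ω ∈ pathEvent R f r t (m * ε t) (ε t) k.1 := by
    refine ae_all_iff.2 fun t => ae_all_iff.2 fun r => ae_all_iff.2 fun m => ?_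
    set K := birthIntensity d lam (Metric.closedBall 0 (r : ℝ) ×ˢ Set.Iic (t : ℝ))
    have hK : K ≠ ∞ := (birthIntensity_ball_prod_lt_top _ _ _).ne
    have h2 : ∀ n : ℕ, P (⋂ n : ℕ, ⋃ k : {k : Fin (n + 1) → ℕ // Function.Injective k},
        pathEvent R f r t (m * ε t) (ε t) k.1) ≤ 2⁻¹ ^ n * K := by
      intro n
      refine (measure_mono (Set.iInter_subset _ n)).trans ((measure_iUnion_le _).trans ?_)
      refine (hR.tsum_pathEvent_le hc hb hfm hf r t _ (hε t).le n).trans ?_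
      exact mul_le_mul' (pow_le_pow_left₀ zero_le (hhalf t) n) le_rfl
    have h3 : Tendsto (fun n : ℕ => (2⁻¹ : ℝ≥0∞) ^ n * K) atTop (nhds (0 * K)) :=
      ENNReal.Tendsto.mul_const (ENNReal.tendsto_pow_atTop_nhds_zero_of_lt_one (by simp))
        (.inr hK)
    rw [zero_mul] at h3
    have h4 := le_antisymm (ge_of_tendsto' h3 h2) zero_le
    filter_upwards [measure_eq_zero_iff_ae_notMem.1 h4] with ω hω
    simpa using hω
  filter_upwards [h1, hR.ae_clock_pos hc hb, hR.ae_birth_nonneg] with ω h1 h2 h3 t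
  refine ⟨ε t, hε t, fun m v => ?_⟩
  by_cases hv : (R ω).birth (Sum.inr v) ≤ t
  swap
  -- A point born after `t` has no connection before `t`, so a path of one edge is already
  -- impossible.
  · refine ⟨1, fun ⟨k, _, hkv, hki⟩ => hv ?_⟩
    obtain ⟨h4, h5, h6⟩ := hki 0
    rw [Realization.T_symm] at h4 h5 h6
    have h7 := (Realization.mem_connectSet hf (h3 _) (h2 _) (Nat.cast_nonneg t)
      (by simpa using h4) h5 h6).1
    rwa [show k (Fin.castSucc 0) = v from hkv] at h7
  obtain ⟨r, hr⟩ := exists_nat_ge ‖((R ω).y v).1‖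
  obtain ⟨n, hn⟩ := h1 t r m
  refine ⟨n, fun ⟨k, hk, hkv, hki⟩ => hn ⟨⟨k, hk⟩, ⟨?_, ?_⟩, fun i => ?_⟩⟩
  · simpa [PtSpace.pos, Realization.points, hkv] using hr
  · simpa [PtSpace.pos, Realization.points, Realization.birth, hkv] using hv
  · exact (Realization.mem_connectSet hf (h3 _) (h2 _) (Nat.cast_nonneg t)
      (by simpa using (hki i).1) (hki i).2.1 (hki i).2.2).2

/-- Points of the augmentation have finitely many connections to points of `Ψ` in bounded time. -/
lemma ae_finite_degree_augmentation (hR : IsRandomSystem P lam R)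
    (hc : ∀ s, Measurable fun ω => (R ω).clock s) (hb : ∀ s, Measurable fun ω => (R ω).coin s)
    (hfm : Measurable f) (hf : ∀ r, 0 ≤ r → 0 ≤ f r)
    (hf_int : Integrable (fun x : EuclideanSpace ℝ (Fin d) => f ‖x‖)) :
    ∀ᵐ ω ∂P, ∀ j : ℕ, ∀ t : ℕ, {k : ℕ | (R ω).T f (Sum.inl j) (Sum.inr k) ≤ t}.Finite := by
  have h1 : ∀ᵐ ω ∂P, ∀ j t : ℕ, {k : ℕ | ω ∈ {ω | ((R ω).points,
      (R ω).clock s(Sum.inl j, Sum.inr k)) ∈ connectSet f t 0 t (Sum.inl j) (Sum.inr k)}}.Finite := by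
    refine ae_all_iff.2 fun j => ae_all_iff.2 fun t => ae_finite_setOfPred_mem (ne_of_lt ?_)
    have hcb := measurable_connectBound (d := d) hfm t t
    have hzm : Measurable fun ω => ((R ω).z j, (0 : ℝ)) :=
      (hR.measurable_z j).prodMk measurable_const
    have h2 : ∀ k : ℕ, P {ω | ((R ω).points, (R ω).clock s(Sum.inl j, Sum.inr k)) ∈
        connectSet f t 0 t (Sum.inl j) (Sum.inr k)} ≤
        ∫⁻ ω, connectBound f t t ((R ω).z j, 0) ((R ω).y k) ∂P := by
      intro k
      have h := hR.measure_path_le hc hb hfm hf t 0 t (n := 1) (A := Set.univ)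
        (k := ![Sum.inl j, Sum.inr k])
        (by intro a b; fin_cases a <;> fin_cases b <;> simp) MeasurableSet.univ
      simpa [Realization.pos_points, Realization.loc, Realization.birth] using h
    -- The augmentation is independent of `Ψ`, so its `j`-th point can be frozen at `x` and
    -- Campbell's formula applied for each `x`.
    have h3 : ∀ k : ℕ, ∫⁻ ω, connectBound f t t ((R ω).z j, 0) ((R ω).y k) ∂P =
        ∫⁻ x, ∫⁻ ω, connectBound f t t x ((R ω).y k) ∂P
          ∂(P.map fun ω => ((R ω).z j, (0 : ℝ))) := by
      intro k
      have hyk := hR.poisson.measurable k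
      have hind : IndepFun (fun ω => ((R ω).z j, (0 : ℝ))) (fun ω => (R ω).y k) P :=
        hR.indep_Z_Psi.comp
          (φ := fun x : ℕ∞ × (ℕ → EuclideanSpace ℝ (Fin d)) => (x.2 j, (0 : ℝ)))
          (ψ := fun x : ℕ → EuclideanSpace ℝ (Fin d) × ℝ => x k)
          (Measurable.prodMk (by fun_prop) measurable_const) (by fun_prop)
      have hmap := (indepFun_iff_map_prod_eq_prod_map_map hzm.aemeasurable
        hyk.aemeasurable).1 hind
      have := Measure.isProbabilityMeasure_map (μ := P) hyk.aemeasurable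
      have h4 := lintegral_map (μ := P) hcb (hzm.prodMk hyk)
      rw [hmap, lintegral_prod _ hcb.aemeasurable] at h4
      refine h4.symm.trans (lintegral_congr fun x => ?_)
      exact lintegral_map (hcb.comp (measurable_const.prodMk measurable_id)) hyk
    have := Measure.isProbabilityMeasure_map (μ := P) hzm.aemeasurable
    calc _ ≤ ∑' k : ℕ, ∫⁻ ω, connectBound f t t ((R ω).z j, 0) ((R ω).y k) ∂P :=
          ENNReal.tsum_le_tsum h2
      _ = ∫⁻ x, ∑' k : ℕ, ∫⁻ ω, connectBound f t t x ((R ω).y k) ∂P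
          ∂(P.map fun ω => ((R ω).z j, (0 : ℝ))) := by
          rw [lintegral_tsum fun k => Measurable.aemeasurable ?_]
          · exact tsum_congr h3
          · have h5 : Measurable (Function.uncurry fun (x : EuclideanSpace ℝ (Fin d) × ℝ) ω =>
                connectBound f t t x ((R ω).y k)) :=
              hcb.comp (measurable_fst.prodMk ((hR.poisson.measurable k).comp measurable_snd))
            exact h5.lintegral_prod_right'
      _ = ∫⁻ _, meanDegree d lam f t t ∂(P.map fun ω => ((R ω).z j, (0 : ℝ))) := by
          refine lintegral_congr fun x => ?_
          have hx : Measurable fun x' => connectBound f t t x x' :=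
            hcb.comp (measurable_const.prodMk measurable_id)
          rw [hR.poisson.tsum_lintegral hx,
            lintegral_connectBound hfm t (Nat.cast_nonneg t) lam x]
          rfl
      _ < ∞ := by
          rw [lintegral_const, measure_univ, mul_one]
          exact meanDegree_lt_top hf_int _ _
  filter_upwards [h1, hR.ae_clock_pos hc hb, hR.ae_birth_nonneg] with ω h1 h2 h3 j t
  refine (h1 j t).subset fun k hk => ?_
  have hk : (R ω).T f (Sum.inl j) (Sum.inr k) ≤ t := hk
  have hk' : (R ω).T f (Sum.inl j) (Sum.inr k) ≤ ENNReal.ofReal t := by simpa using hk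
  have htr : ((R ω).T f (Sum.inl j) (Sum.inr k)).toReal ≤ t :=
    ENNReal.toReal_le_of_le_ofReal (Nat.cast_nonneg t) hk'
  exact (Realization.mem_connectSet hf (h3 _) (h2 _) (Nat.cast_nonneg t) hk'
    ENNReal.toReal_nonneg (by simpa using htr)).2

end IsRandomSystem

/-! ### Random environment and proof of the theorem -/

namespace IsRandomSystem

variable {Ω : Type*} [MeasurableSpace Ω] {P : Measure Ω} {d : ℕ}
  {lam : ℝ} {R : Ω → Realization d} {f : ℝ → ℝ}

/-- The connection times as functions of the configuration of points and of the clocks. -/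
noncomputable def timeOf (f : ℝ → ℝ) (x : PtSpace d) (c : Sym2 PtLabel → ℝ) (p q : PtLabel) :
    ℝ≥0∞ :=
  if f ‖(x.pos p).1 - (x.pos q).1‖ = 0 then ∞
  else ENNReal.ofReal
    (max (x.pos p).2 (x.pos q).2 + c s(p, q) / (2 * f ‖(x.pos p).1 - (x.pos q).1‖))

lemma T_eq_timeOf (c : Realization d) (f : ℝ → ℝ) (p q : PtLabel) :
    c.T f p q = timeOf f c.points c.clock p q := by
  simp only [timeOf, Realization.pos_points, Realization.T]

lemma measurable_timeOf {α : Type*} [MeasurableSpace α] {X : α → PtSpace d}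
    {C : α → Sym2 PtLabel → ℝ} (hf : Measurable f) (hX : Measurable X)
    (hC : ∀ s, Measurable fun a => C a s) (p q : PtLabel) :
    Measurable fun a => timeOf f (X a) (C a) p q := by
  have hp : Measurable fun a => (X a).pos p := (measurable_pos p).comp hX
  have hq : Measurable fun a => (X a).pos q := (measurable_pos q).comp hX
  have h2 : Measurable fun a => f ‖((X a).pos p).1 - ((X a).pos q).1‖ :=
    hf.comp (hp.fst.sub hq.fst).norm
  exact Measurable.ite (h2 (measurableSet_singleton 0)) measurable_const
    ((hp.snd.max hq.snd).add ((hC s(p, q)).div (h2.const_mul 2))).ennreal_ofReal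

/-- The labels of the points of a configuration. -/
def ptsOf (x : PtSpace d) : Set PtLabel := {p | ∀ k : ℕ, p = Sum.inl k → (k : ℕ∞) < x.1.1}

lemma pts_eq_ptsOf (c : Realization d) : c.pts = ptsOf c.points := by
  ext p
  cases p <;> simp [Realization.pts, Realization.ptsZ, Realization.ptsPsi, ptsOf, Realization.points]

lemma measurable_ptsOf : Measurable (ptsOf (d := d)) := by
  refine measurable_set_iff.2 fun p => Measurable.forall fun k => measurable_const.imp ?_
  have h : Measurable fun x : PtSpace d => x.1.1 := by fun_prop
  exact measurableSet_setOfPred.1 (h (Set.to_countable (Set.Ioi (k : ℕ∞))).measurableSet)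

/-! ### Absence of ties -/

lemma ae_ne_of_indepFun [IsProbabilityMeasure P] {β : Type*} [MeasurableSpace β] {X : Ω → ℝ} {W : Ω → β}
    (hX : Measurable X) (hW : Measurable W) (h : IndepFun W X P) [NullSingletonClass (P.map X)] {φ : β → ℝ}
    (hφ : Measurable φ) : ∀ᵐ ω ∂P, X ω ≠ φ (W ω) := by
  have hmap := (indepFun_iff_map_prod_eq_prod_map_map hW.aemeasurable hX.aemeasurable).1 h
  have hS : MeasurableSet {w : β × ℝ | w.2 = φ w.1} :=
    measurableSet_eq_fun measurable_snd (hφ.comp measurable_fst)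
  have h1 : P.map (fun ω => (W ω, X ω)) {w : β × ℝ | w.2 = φ w.1} = 0 := by
    rw [hmap, Measure.measure_prod_null hS]
    refine ae_of_all _ fun w => ?_
    have : Prod.mk w ⁻¹' {w : β × ℝ | w.2 = φ w.1} = {φ w} := by ext x; simp
    change P.map X (Prod.mk w ⁻¹' {w : β × ℝ | w.2 = φ w.1}) = 0
    rw [this]
    simp
  rw [Measure.map_apply (hW.prodMk hX) hS] at h1
  exact measure_eq_zero_iff_ae_notMem.1 h1

lemma ae_no_ties [IsProbabilityMeasure P] (hR : IsRandomSystem P lam R)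
    (hc : ∀ s, Measurable fun ω => (R ω).clock s) (hb : ∀ s, Measurable fun ω => (R ω).coin s)
    (hfm : Measurable f) (hf : ∀ r, 0 ≤ r → 0 ≤ f r) :
    ∀ᵐ ω ∂P, ∀ p q p' q' : PtLabel, (R ω).T f p q = (R ω).T f p' q' → (R ω).T f p q ≠ ∞ →
      s(p, q) = s(p', q') := by
  have h1 : ∀ p q p' q' : PtLabel, ∀ᵐ ω ∂P, (R ω).T f p q = (R ω).T f p' q' →
      (R ω).T f p q ≠ ∞ → s(p, q) = s(p', q') := by
    intro p q p' q'
    by_cases hne : s(p, q) = s(p', q')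
    · exact ae_of_all _ fun _ _ _ => hne
    have hi1 : IndepFun (fun ω => (R ω).clock s(p, q)) (fun ω => (R ω).clock s(p', q')) P :=
      hR.iIndepFun_clock.indepFun hne
    have hi2 : IndepFun (fun ω => ((R ω).clock s(p, q), (R ω).clock s(p', q')))
        (fun ω => (R ω).points) P :=
      hR.indepFun_points_clock.symm.comp
        (φ := fun c : Sym2 PtLabel → ℝ => (c s(p, q), c s(p', q'))) (ψ := id)
        (by fun_prop) measurable_id
    have hi := (hi1.prodMk_right_of_prodMk_left (hc _) (hc _) hR.measurable_points hi2).symm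
    have : NullSingletonClass (P.map fun ω => (R ω).clock s(p, q)) := by
      rw [hR.map_clock hc hb]
      exact ⟨fun x => le_antisymm ((expMeasure_one_le_volume _).trans (by simp)) zero_le⟩
    have hpos : ∀ p, Measurable fun w : ℝ × PtSpace d => w.2.pos p :=
      fun p => (measurable_pos p).comp measurable_snd
    have hfpos : ∀ p q, Measurable fun w : ℝ × PtSpace d =>
        f ‖(w.2.pos p).1 - (w.2.pos q).1‖ :=
      fun p q => hfm.comp ((hpos p).fst.sub (hpos q).fst).norm
    -- A tie at a finite time forces the clock of `s(p, q)` to equal this function of the other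
    -- clock and the points. The clock is independent of these and has no atoms.
    have hφ : Measurable fun w : ℝ × PtSpace d => 2 * f ‖(w.2.pos p).1 - (w.2.pos q).1‖ *
        (max (w.2.pos p').2 (w.2.pos q').2 + w.1 / (2 * f ‖(w.2.pos p').1 - (w.2.pos q').1‖) -
          max (w.2.pos p).2 (w.2.pos q).2) :=
      ((hfpos p q).const_mul 2).mul ((((hpos p').snd.max (hpos q').snd).add
        (measurable_fst.div ((hfpos p' q').const_mul 2))).sub ((hpos p).snd.max (hpos q).snd))
    filter_upwards [ae_ne_of_indepFun (hc _) ((hc _).prodMk hR.measurable_points) hi hφ,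
      hR.ae_T_pos hf hc hb] with ω h2 h3 heq hT
    exfalso
    refine h2 ?_
    have h4 := h3 p q
    have h5 := h3 p' q'
    have hT' := heq ▸ hT
    rw [T_eq_timeOf] at hT hT' heq h4 h5
    rw [T_eq_timeOf (R ω) f p' q'] at heq
    unfold timeOf at hT hT' heq h4 h5
    split_ifs at hT hT' heq h4 h5 with hf1 hf2
    · exact absurd rfl hT
    · exact absurd rfl hT
    · exact absurd rfl hT'
    · rw [ENNReal.ofReal_pos] at h4 h5
      rw [ENNReal.ofReal_eq_ofReal_iff h4.le h5.le] at heq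
      rw [← heq]
      field_simp
      ring
  simp only [ae_all_iff]
  exact h1

/-! ### Independence of the coins -/

lemma indepFun_mark_others (hR : IsRandomSystem P lam R)
    (hc : ∀ s, Measurable fun ω => (R ω).clock s) (hb : ∀ s, Measurable fun ω => (R ω).coin s)
    (s : Sym2 PtLabel) :
    IndepFun (fun ω => ((R ω).clock s, (R ω).coin s))
      (fun ω (s' : {s' // s' ≠ s}) => ((R ω).clock s', (R ω).coin s')) P := by
  have h := indep_iSup_of_disjoint (fun s => ((hc s).prodMk (hb s)).comap_le)
    hR.iIndepFun_mark (S := {s}) (T := {s}ᶜ) (by simp)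
  refine indep_of_indep_of_le_right (indep_of_indep_of_le_left h ?_) ?_
  · exact le_iSup₂_of_le s rfl le_rfl
  · rw [MeasurableSpace.pi, MeasurableSpace.comap_iSup]
    refine iSup_le fun s' => ?_
    rw [MeasurableSpace.comap_comp]
    exact le_iSup₂_of_le s'.1 s'.2 le_rfl

/-- The independent blocks are adjoined one at a time: the clock of the same pair, the marks of the
other pairs, the points. -/
lemma indepFun_coin [IsProbabilityMeasure P] (hR : IsRandomSystem P lam R)
    (hc : ∀ s, Measurable fun ω => (R ω).clock s) (hb : ∀ s, Measurable fun ω => (R ω).coin s)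
    (s : Sym2 PtLabel) :
    IndepFun (fun ω => (R ω).coin s) (fun ω => (((R ω).clock s,
      fun (s' : {s' // s' ≠ s}) => ((R ω).clock s', (R ω).coin s')), (R ω).points)) P := by
  have := isProbabilityMeasure_expMeasure one_pos
  have hm : Measurable fun ω (s' : {s' // s' ≠ s}) => ((R ω).clock s', (R ω).coin s') :=
    measurable_pi_lambda _ fun s' => (hc _).prodMk (hb _)
  have h1 : IndepFun (fun ω => (R ω).clock s) (fun ω => (R ω).coin s) P := by
    rw [indepFun_iff_map_prod_eq_prod_map_map (hc s).aemeasurable (hb s).aemeasurable,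
      hR.map_clock hc hb, hR.map_coin hc hb]
    exact (hR.hasLaw_mark s).map_eq
  have h2 := (hR.indepFun_mark_others hc hb s).comp measurable_swap measurable_id
  have h3 := h1.symm.prodMk_right_of_prodMk_left (hb s) (hc s) hm h2
  refine h3.prodMk_right_of_prodMk_left (hb s) ((hc s).prodMk hm) hR.measurable_points ?_
  refine hR.indep_points_marks.symm.comp (ψ := id)
    (φ := fun m : Sym2 PtLabel → ℝ × Bool => ((m s).2, ((m s).1, fun s' : {s' // s' ≠ s} => m s')))
    (by fun_prop) measurable_id

lemma indepFun_coin_env [IsProbabilityMeasure P] (hR : IsRandomSystem P lam R)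
    (hc : ∀ s, Measurable fun ω => (R ω).clock s) (hb : ∀ s, Measurable fun ω => (R ω).coin s)
    (hfm : Measurable f) (s : Sym2 PtLabel) :
    IndepFun (fun ω => (R ω).coin s)
      (fun ω => ((R ω).T f, (R ω).pts, Function.update (R ω).coin s true)) P := by
  -- Rebuilds all marks, with the coin of `s` set to `true`, from data independent of that coin.
  let C : (ℝ × ({s' // s' ≠ s} → ℝ × Bool)) × PtSpace d → Sym2 PtLabel → ℝ × Bool :=
    fun w s' => if h : s' = s then (w.1.1, true) else w.1.2 ⟨s', h⟩
  have hC : ∀ s', Measurable fun w => C w s' := by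
    intro s'
    by_cases h : s' = s
    · simp only [C, dif_pos h]
      fun_prop
    · simp only [C, dif_neg h]
      fun_prop
  have hψ : Measurable fun w : (ℝ × ({s' // s' ≠ s} → ℝ × Bool)) × PtSpace d =>
      (timeOf f w.2 (fun s' => (C w s').1), ptsOf w.2, fun s' => (C w s').2) := by
    refine Measurable.prodMk (measurable_pi_lambda _ fun p => measurable_pi_lambda _ fun q => ?_)
      ((measurable_ptsOf.comp measurable_snd).prodMk (measurable_pi_lambda _ fun s' => (hC s').snd))
    exact measurable_timeOf hfm measurable_snd (fun s' => (hC s').fst) p q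
  have h := (hR.indepFun_coin hc hb s).comp measurable_id hψ
  refine h.congr EventuallyEq.rfl (ae_of_all _ fun ω => (Prod.ext ?_ (Prod.ext ?_ ?_)).symm)
  rotate_left
  · exact pts_eq_ptsOf _
  rotate_left
  · funext p q
    refine (T_eq_timeOf (R ω) f p q).trans ?_
    refine congrArg (fun c => timeOf f (R ω).points c p q) (a₂ := fun s' => (C (((R ω).clock s,
      fun s' => ((R ω).clock s', (R ω).coin s')), (R ω).points) s').1) (funext fun s' => ?_)
    by_cases h : s' = s
    · subst h
      simp [C]
    · simp [C, h]
  · funext s'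
    by_cases h : s' = s
    · subst h
      simp [C]
    · simp [C, h]

/-! ### The connection times are almost surely well behaved -/

lemma ae_good [IsProbabilityMeasure P] (hR : IsRandomSystem P lam R) (hZ : IsAdmissibleAugmentation P f R)
    (hc : ∀ s, Measurable fun ω => (R ω).clock s) (hb : ∀ s, Measurable fun ω => (R ω).coin s)
    (hfm : Measurable f) (hf : ∀ r, 0 ≤ r → 0 ≤ f r) (hf0 : f 0 = 0)
    (hf_int : Integrable (fun x : EuclideanSpace ℝ (Fin d) => f ‖x‖)) :
    ∀ᵐ ω ∂P, Interaction.Good ((R ω).T f) (R ω).pts := by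
  filter_upwards [hR.ae_T_pos hf hc hb, hR.ae_finite_degree hc hb hfm hf hf_int,
    hR.ae_finite_degree_augmentation hc hb hfm hf hf_int,
    hR.ae_no_long_path hc hb hfm hf hf_int, hR.ae_no_ties hc hb hfm hf, hZ.finite_connections,
    hZ.no_decreasing_chain] with ω hpos hdeg hdegZ hpath hties hfin hchain
  have hself : ∀ p, (R ω).T f p p = ∞ := fun p => by simp [Realization.T, hf0]
  have hdegPsi : ∀ p : PtLabel, ∀ t : ℕ, {k : ℕ | (R ω).T f p (Sum.inr k) ≤ t}.Finite := by
    rintro (j | j) t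
    · exact hdegZ j t
    · exact hdeg j t
  refine ⟨(R ω).T_symm f, hself, fun p _ q _ => hpos p q, fun p hp t ht => ?_, ?_,
    fun p _ q _ p' _ q' _ => hties p q p' q'⟩
  · obtain ⟨n, hn⟩ := exists_nat_ge t.toReal
    have htn : t ≤ n := by
      rw [← ENNReal.ofReal_toReal ht.ne, ← ENNReal.ofReal_natCast]
      exact ENNReal.ofReal_le_ofReal hn
    refine ((hfin p hp t.toNNReal).union ((hdegPsi p n).image Sum.inr)).subset ?_
    rintro q ⟨hq | ⟨k, rfl⟩, hqt⟩
    · refine .inl ⟨hq, ?_⟩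
      rwa [ENNReal.coe_toNNReal ht.ne]
    · exact .inr ⟨k, hqt.trans htn, rfl⟩
  · rintro ⟨s, hs, hanti⟩
    -- By admissibility the chain leaves the augmentation for good, so a tail of it lies in `Ψ`,
    -- where the path bound applies.
    have h1 : ¬ ∃ᶠ n in atTop, s n ∈ (R ω).ptsZ := fun h => hchain ⟨s, hs, h, hanti⟩
    obtain ⟨N, hN⟩ := eventually_atTop.1 (not_frequently.1 h1)
    have h2 : ∀ n, ∃ k : ℕ, s (N + n) = Sum.inr k := fun n => by
      rcases hs (N + n) with h | ⟨k, hk⟩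
      · exact absurd h (hN _ (by omega))
      · exact ⟨k, hk.symm⟩
    choose k hk using h2
    refine not_exists_strictAnti_of_paths (T := fun i j : ℕ => (R ω).T f (Sum.inr i) (Sum.inr j))
      (fun i j => (R ω).T_symm f _ _) (fun i => hself _) (fun i t => ?_) hpath
      ⟨k, fun i j hij => ?_⟩
    · obtain ⟨n, hn⟩ := exists_nat_ge t
      refine (hdeg i n).subset fun j hj => le_trans (b := (t : ℝ≥0∞)) hj ?_
      exact_mod_cast hn
    · have h3 := hanti (show N + i < N + j by omega)
      simpa only [← hk, add_assoc] using h3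

lemma coin_prob (hR : IsRandomSystem P lam R)
    (hc : ∀ s, Measurable fun ω => (R ω).clock s) (hb : ∀ s, Measurable fun ω => (R ω).coin s)
    (s : Sym2 PtLabel) (b : Bool) : P {ω | (R ω).coin s = b} = 2⁻¹ := by
  have h := congrArg (fun μ => μ {b}) (hR.map_coin hc hb s)
  change P.map _ {b} = _ at h
  rw [Measure.map_apply (hb s) (measurableSet_singleton b),
    PMF.toMeasure_apply_singleton _ _ (measurableSet_singleton b)] at h
  exact h.trans (by simp [PMF.uniformOfFintype_apply])

/-- The main result, for measurable marks. -/
theorem ae_family_finite [IsProbabilityMeasure P] (hR : IsRandomSystem P lam R) (hZ : IsAdmissibleAugmentation P f R)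
    (hc : ∀ s, Measurable fun ω => (R ω).clock s) (hb : ∀ s, Measurable fun ω => (R ω).coin s)
    (hfm : Measurable f) (hf : ∀ r, 0 ≤ r → 0 ≤ f r) (hf0 : f 0 = 0)
    (hf_int : Integrable (fun x : EuclideanSpace ℝ (Fin d) => f ‖x‖)) :
    ∀ᵐ ω ∂P,
      (∃! e : PtLabel → ℝ≥0∞, (R ω).IsDeathTimes f (R ω).ptsPsi e) ∧
      (∃! e' : PtLabel → ℝ≥0∞, (R ω).IsDeathTimes f (R ω).pts e') ∧
      ∀ e e' : PtLabel → ℝ≥0∞,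
        (R ω).IsDeathTimes f (R ω).ptsPsi e → (R ω).IsDeathTimes f (R ω).pts e' →
          ∀ z ∈ (R ω).ptsZ, ∀ t₁ : ℝ≥0∞, ((R ω).family f e e' t₁ z).Finite := by
  classical
  have hgood := hR.ae_good hZ hc hb hfm hf hf0 hf_int
  have hE : Measurable fun ω => (((R ω).T f, (R ω).pts, (R ω).coin) : Interaction.Env PtLabel) := by
    refine Measurable.prodMk (measurable_pi_lambda _ fun p => measurable_pi_lambda _ fun q => ?_)
      (Measurable.prodMk ?_ (measurable_pi_lambda _ hb))
    · simp_rw [T_eq_timeOf]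
      exact measurable_timeOf hfm hR.measurable_points hc p q
    · simp_rw [pts_eq_ptsOf]
      exact measurable_ptsOf.comp hR.measurable_points
  have hmeet : ∀ᵐ ω ∂P, ∀ z, (Interaction.meetings ((R ω).T f) (R ω).I (R ω).pts
      (Set.range Sum.inr) z).Finite := by
    refine ae_all_iff.2 fun z => ?_
    refine Interaction.ae_finite_meetings (B := Set.range Sum.inr)
      (o := fun p q => decide (Encodable.encode p < Encodable.encode q)) hE hgood
      (fun ω => Set.subset_union_right) (fun s => ?_) (hR.coin_prob hc hb) (fun p q hpq => ?_) z
    · exact hR.indepFun_coin_env hc hb hfm s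
    · have : Encodable.encode p ≠ Encodable.encode q := fun h => hpq (Encodable.encode_injective h)
      simp only [← decide_not]
      exact decide_eq_decide.2 ⟨fun h => h.not_gt, fun h => lt_of_le_of_ne (not_lt.1 h) this.symm⟩
  filter_upwards [hgood, hmeet] with ω hG hm
  exact ⟨hG.existsUnique_death Set.subset_union_right, hG.existsUnique_death subset_rfl,
    fun e e' he he' z _ t => Realization.family_finite hG he he' (hm z) t⟩

/-- The marks of a random system may be taken to be measurable. -/
lemma exists_measurable_marks (hR : IsRandomSystem P lam R) :
    ∃ R' : Ω → Realization d, IsRandomSystem P lam R' ∧ (∀ᵐ ω ∂P, R' ω = R ω) ∧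
      (∀ s, Measurable fun ω => (R' ω).clock s) ∧ ∀ s, Measurable fun ω => (R' ω).coin s := by
  -- `HasLaw` yields only almost everywhere measurability. As there are countably many pairs, the
  -- measurable versions agree with all marks simultaneously, almost surely.
  let m : Sym2 PtLabel → Ω → ℝ × Bool := fun s => (hR.hasLaw_mark s).aemeasurable.mk _
  have hm : ∀ s, Measurable (m s) := fun s => (hR.hasLaw_mark s).aemeasurable.measurable_mk
  have heq : ∀ s, (fun ω => ((R ω).clock s, (R ω).coin s)) =ᵐ[P] m s :=
    fun s => (hR.hasLaw_mark s).aemeasurable.ae_eq_mk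
  refine ⟨fun ω => { R ω with clock := fun s => (m s ω).1, coin := fun s => (m s ω).2 },
    ⟨hR.poisson, hR.measurable_numZ, hR.measurable_z, hR.locallyFinite_Z, hR.indep_Z_Psi,
      fun s => (hR.hasLaw_mark s).congr (heq s).symm, hR.iIndepFun_mark.congr heq,
      hR.indep_points_marks.congr EventuallyEq.rfl ?_⟩, ?_,
    fun s => (hm s).fst, fun s => (hm s).snd⟩
  · filter_upwards [ae_all_iff.2 heq] with ω hω
    funext s
    exact hω s
  · filter_upwards [ae_all_iff.2 heq] with ω hω
    have h1 : (fun s => (m s ω).1) = (R ω).clock := funext fun s => by rw [← hω s]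
    have h2 : (fun s => (m s ω).2) = (R ω).coin := funext fun s => by rw [← hω s]
    simp only [h1, h2]

end IsRandomSystem

lemma IsAdmissibleAugmentation.congr {Ω : Type*} [MeasurableSpace Ω] {P : Measure Ω} {d : ℕ}
    {f : ℝ → ℝ} {R R' : Ω → Realization d} (h : IsAdmissibleAugmentation P f R)
    (heq : ∀ᵐ ω ∂P, R' ω = R ω) : IsAdmissibleAugmentation P f R' := by
  refine ⟨?_, ?_⟩
  · filter_upwards [h.finite_connections, heq] with ω h1 h2
    rwa [h2]
  · filter_upwards [h.no_decreasing_chain, heq] with ω h1 h2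
    rwa [h2]

theorem mainTheorem8 {Ω : Type*} [MeasurableSpace Ω] (P : Measure Ω) [IsProbabilityMeasure P]
    (d : ℕ) (lam : ℝ) (hlam : 0 < lam)
    (f : ℝ → ℝ) (hf_meas : Measurable f)
    (hf_nonneg : ∀ r, 0 ≤ r → 0 ≤ f r) (hf_zero : f 0 = 0)
    (hf_int : Integrable (fun x : EuclideanSpace ℝ (Fin d) => f ‖x‖))
    (hf_pos : 0 < ∫ x : EuclideanSpace ℝ (Fin d), f ‖x‖)
    (R : Ω → Realization d) (hR : IsRandomSystem P lam R)
    (hZ : IsAdmissibleAugmentation P f R) :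
    ∀ᵐ ω ∂P,
      (∃! e : PtLabel → ℝ≥0∞, (R ω).IsDeathTimes f (R ω).ptsPsi e) ∧
      (∃! e' : PtLabel → ℝ≥0∞, (R ω).IsDeathTimes f (R ω).pts e') ∧
      ∀ e e' : PtLabel → ℝ≥0∞,
        (R ω).IsDeathTimes f (R ω).ptsPsi e → (R ω).IsDeathTimes f (R ω).pts e' →
          ∀ z ∈ (R ω).ptsZ, ∀ t₁ : ℝ≥0∞, ((R ω).family f e e' t₁ z).Finite := by
  obtain ⟨R', hR', heq, hc, hb⟩ := hR.exists_measurable_marks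
  filter_upwards [hR'.ae_family_finite (hZ.congr heq) hc hb hf_meas hf_nonneg hf_zero hf_int,
    heq] with ω h1 h2
  rwa [h2] at h1
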